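/- Let $0<q<1$ and let $\alpha,\beta>-1$ be real. Write $(a;q)_n=\prod_{k=0}^{n-1}(1-aq^k)$, $(a_1,\dots,a_r;q)_n=\prod_s(a_s;q)_n$, $(a;q)_\infty=\prod_{k\ge0}(1-aq^k)$, $(a;q)_\nu=(a;q)_\infty/(aq^\nu;q)_\infty$ for real $\nu$, and $\int_0^b f(x)\,d_qx=(1-q)\sum_{k\ge0}bq^kf(bq^k)$. Put $$\omega(x;q)=q^{-\frac{\alpha+1}{8}}x^{\frac{\alpha-1}{2}}(qx;q)_{\frac{\beta-1}{2}},\qquad \langle\phi,\psi\rangle=\int_0^1\int_0^{q^{1/2}y}\bigl(\phi(x)\psi(y)-\phi(y)\psi(x)\bigr)\omega(x;q)\omega(y;q)\,d_qx\,d_qy,$$ and let $p_n=p_n(x;q^{1/2})$ be the monic little $q$-Jacobi polynomials in base $q^{1/2}$, $$p_n(x;q^{1/2})=(-1)^nq^{\frac{n(n-1)}4}\frac{(q^{\frac{\alpha+1}2};q^{\frac12})_n}{(q^{\frac{\alpha+\beta+n+1}2};q^{\frac12})_n}\sum_{r=0}^n\frac{(q^{-\frac n2};q^{\frac12})_r\,(q^{\frac{\alpha+\beta+n+1}2};q^{\frac12})_r}{(q^{\frac12};q^{\frac12})_r\,(q^{\frac{\alpha+1}2};q^{\frac12})_r}(q^{\frac12}x)^r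 .$$ The double series defining $\langle\phi,\psi\rangle$ converges absolutely for all polynomials $\phi,\psi$. (a) There is exactly one family of monic polynomials $Q_0,Q_1,\dots$ with real coefficients, $\deg Q_n=n$, such that $\langle Q_{2m},Q_{2n}\rangle=\langle Q_{2m+1},Q_{2n+1}\rangle=0$ and $\langle Q_{2m},Q_{2n+1}\rangle=u_m\delta_{m,n}$ with $u_m\ne0$, normalized so that the expansion of $Q_{2j+1}$ in the $p_k$ has no $p_{2j}$ term. It is given by $Q_{2j}=p_{2j}$ $(j\ge0)$, $Q_1=p_1$ and, for $j\ge1$, $$Q_{2j+1}=p_{2j+1}-\frac{q^{2j+\frac\alpha2}(1-q^{j+\frac{\alpha+\beta}2})(1-q^{j+\frac\alpha2})(1-q^{j+\frac\beta2})(1-q^j)}{(1-q^{2j+\frac{\alpha+\beta+2}2})(1-q^{2j+\frac{\alpha+\beta+1}2})(1-q^{2j+\frac{\alpha+\beta}2})(1-q^{2j+\frac{\alpha+\beta-1}2})}\,p_{2j-1}.$$ (b) Equivalently, this family is characterized by $p_{2j}=Q_{2j}$ and $$p_{2j+1}=\sum_{i=0}^j\frac{q^{(j-i)(i+j+1+\frac\alpha2)}\,(q^{i+1+\frac{\alpha+\beta}2},q^{i+1+\frac\alpha2},q^{i+1+\frac\beta2},q^{i+1};q)_{j-i}}{(q^{2i+\frac{\alpha+\beta+3}2};q^{\frac12})_{4(j-i)}}\,Q_{2i+1}\qquad(j\ge0).$$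 (c) For every integer $n\ge0$, $$\int_{z_1=0}^1\int_{z_2=0}^{q^{1/2}z_1}\!\cdots\int_{z_{2n}=0}^{q^{1/2}z_{2n-1}}\prod_{1\le j<k\le 2n}(z_j-z_k)\prod_{i=1}^{2n}z_i^{\frac{\alpha-1}2}(qz_i;q)_{\frac{\beta-1}2}\,d_qz_i$$ $$=q^{\frac16n(n-1)(4n+3\alpha+1)+\frac14n(\alpha+1)}(1-q)^{2n}\prod_{i=0}^{n-1}\frac{(q^{\frac12};q^{\frac12})_{2i+\alpha+\beta}\,(q^{\frac12};q^{\frac12})_{2i+\alpha}\,(q^{\frac12};q^{\frac12})_{2i+\beta}\,(q^{\frac12};q^{\frac12})_{2i}}{(q^{\frac12};q^{\frac12})_{4i+\alpha+\beta+2}\,(q^{\frac12};q^{\frac12})_{4i+\alpha+\beta}},$$ the multiple series on the left converging absolutely. For all parameters the quotient $(q^{1/2};q^{1/2})_{2i+\alpha+\beta}/(q^{1/2};q^{1/2})_{4i+\alpha+\beta}$ may be written as $1/(q^{(2i+\alpha+\beta+1)/2};q^{1/2})_{2i}$, and it is read this way when $\alpha+\beta=-1$. -/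

import Mathlib

open Polynomial

noncomputable section

/-- The `q`-shifted factorial `(a;q)_n = ∏_{k<n} (1 - a q^k)`. -/
def qPoch (a q : ℝ) (n : ℕ) : ℝ :=
  ∏ k ∈ Finset.range n, (1 - a * q ^ k)

/-- The infinite product `(a;q)_∞ = ∏_{k≥0} (1 - a q^k)`. -/
def qPochInf (a q : ℝ) : ℝ :=
  ∏' k : ℕ, (1 - a * q ^ k)

/-- The `q`-shifted factorial with arbitrary real index,
`(a;q)_ν = (a;q)_∞ / (a q^ν;q)_∞`. -/
def qPochReal (a q ν : ℝ) : ℝ :=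
  qPochInf a q / qPochInf (a * q ^ ν) q

/-- Jackson's integral `∫_0^b f(x) d_q x = (1 - q) ∑_{k≥0} b q^k f(b q^k)`. -/
def jackson (q b : ℝ) (f : ℝ → ℝ) : ℝ :=
  (1 - q) * ∑' k : ℕ, b * q ^ k * f (b * q ^ k)

/-- The skew inner product
`∫_0^1 ∫_0^{q^{1/2} y} (φ(x)ψ(y) - φ(y)ψ(x)) ω(x) ω(y) d_q x d_q y`. -/
def skewInner (q : ℝ) (ω φ ψ : ℝ → ℝ) : ℝ :=
  jackson q 1 fun y => jackson q (q ^ (1 / 2 : ℝ) * y) fun x =>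
    (φ x * ψ y - φ y * ψ x) * ω x * ω y

/-- The term of the double series defining `skewInner` that belongs to the lattice points
`y = q^k` and `x = q^{1/2} q^k q^l`. -/
def skewInnerTerm (q : ℝ) (ω φ ψ : ℝ → ℝ) (k l : ℕ) : ℝ :=
  let y : ℝ := q ^ k
  let x : ℝ := q ^ (1 / 2 : ℝ) * q ^ k * q ^ l
  x * y * ((φ x * ψ y - φ y * ψ x) * ω x * ω y)

/-- The weight `q^{-(α+1)/8} x^{(α-1)/2} (q x;q)_{(β-1)/2}`. -/
def skewWeight (α β q x : ℝ) : ℝ :=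
  q ^ (-(α + 1) / 8) * x ^ ((α - 1) / 2) * qPochReal (q * x) q ((β - 1) / 2)

/-- The monic little `q`-Jacobi polynomial of degree `n` in base `b` :
`(-1)^n b^{n(n-1)/2} (b^{α+1};b)_n / (b^{α+β+n+1};b)_n` times the terminating series
`∑_r (b^{-n};b)_r (b^{α+β+n+1};b)_r / ((b;b)_r (b^{α+1};b)_r) (b x)^r`. -/
def monicLittleQJacobi (α β b : ℝ) (n : ℕ) : ℝ[X] :=
  C ((-1) ^ n * b ^ (n * (n - 1) / 2) *
      qPoch (b ^ (α + 1)) b n / qPoch (b ^ (α + β + n + 1)) b n) *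
    ∑ r ∈ Finset.range (n + 1),
      C (qPoch (b ^ (-(n : ℝ))) b r * qPoch (b ^ (α + β + n + 1)) b r /
          (qPoch b b r * qPoch (b ^ (α + 1)) b r)) * (C b * X) ^ r

/-- A family `Q 0, Q 1, …` of monic polynomials, `Q n` of degree `n`, is skew orthogonal for the
skew inner product with weight `ω`. -/
structure IsSkewOrthogonal (q : ℝ) (ω : ℝ → ℝ) (Q : ℕ → ℝ[X]) : Prop where
  monic : ∀ n, (Q n).Monic
  natDegree : ∀ n, (Q n).natDegree = n
  even_even : ∀ m n, skewInner q ω (fun x => (Q (2 * m)).eval x)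
    (fun x => (Q (2 * n)).eval x) = 0
  odd_odd : ∀ m n, skewInner q ω (fun x => (Q (2 * m + 1)).eval x)
    (fun x => (Q (2 * n + 1)).eval x) = 0
  even_odd : ∃ u : ℕ → ℝ, (∀ m, u m ≠ 0) ∧
    ∀ m n, skewInner q ω (fun x => (Q (2 * m)).eval x)
      (fun x => (Q (2 * n + 1)).eval x) = if m = n then u m else 0

/-- Skew orthogonality determines `Q (2j+1)` only up to a multiple of `Q (2j)`. The freedom is
removed by asking that the expansion of `Q (2j+1)` in the polynomials `p k` has no `p (2j)` term. -/
def IsNormalizedAgainst (p Q : ℕ → ℝ[X]) : Prop :=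
  ∀ j : ℕ, Q (2 * j + 1) ∈ Submodule.span ℝ (p '' {k | k ≠ 2 * j})

/-- The coefficient of `p_{2j-1}` (up to sign) in the skew orthogonal polynomial `Q_{2j+1}`. -/
def connCoeff (α β q : ℝ) (j : ℕ) : ℝ :=
  q ^ (2 * j + α / 2) *
      ((1 - q ^ (j + (α + β) / 2)) * (1 - q ^ (j + α / 2)) * (1 - q ^ (j + β / 2)) *
        (1 - q ^ j)) /
    ((1 - q ^ (2 * j + (α + β + 2) / 2)) * (1 - q ^ (2 * j + (α + β + 1) / 2)) *
      (1 - q ^ (2 * j + (α + β) / 2)) * (1 - q ^ (2 * j + (α + β - 1) / 2)))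

/-- The coefficient of `Q_{2i+1}` in the little `q`-Jacobi polynomial `p_{2j+1}`, for `i ≤ j`. -/
def invConnCoeff (α β q : ℝ) (j i : ℕ) : ℝ :=
  q ^ (((j : ℝ) - i) * (i + j + 1 + α / 2)) *
      (qPoch (q ^ (i + 1 + (α + β) / 2)) q (j - i) * qPoch (q ^ (i + 1 + α / 2)) q (j - i) *
        qPoch (q ^ (i + 1 + β / 2)) q (j - i) * qPoch (q ^ (i + 1)) q (j - i)) /
    qPoch (q ^ (2 * i + (α + β + 3) / 2)) (q ^ (1 / 2 : ℝ)) (4 * (j - i))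

/-- The lattice point `t` with `t_1 = q^{μ_1}` and `t_{i+1} / t_i = q^{μ_{i+1} + 1/2}`
(the index `i` starts at `0` here). -/
def aomotoPoint (q : ℝ) {N : ℕ} (μ : Fin N → ℕ) (i : Fin N) : ℝ :=
  q ^ ((∑ k ∈ Finset.Iic i, (μ k : ℝ)) + (i : ℝ) / 2)

/-- The term `(1-q)^N f(t) ∏ t_i` of the multiple Jackson integral of `f` over
`0 ≤ z_1 ≤ 1`, `0 ≤ z_{i+1} ≤ q^{1/2} z_i` that belongs to the lattice point given by `μ`. -/
def aomotoTerm (q : ℝ) {N : ℕ} (f : (Fin N → ℝ) → ℝ) (μ : Fin N → ℕ) : ℝ :=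
  (1 - q) ^ N * (f (aomotoPoint q μ) * ∏ i, aomotoPoint q μ i)

/-- `∫_{z_1=0}^1 ∫_{z_2=0}^{q^{1/2} z_1} ⋯ ∫_{z_N=0}^{q^{1/2} z_{N-1}} f(z) d_q z_N ⋯ d_q z_1`. -/
def aomotoIntegral (q : ℝ) {N : ℕ} (f : (Fin N → ℝ) → ℝ) : ℝ :=
  ∑' μ : Fin N → ℕ, aomotoTerm q f μ

/-- The integrand
`∏_{j<k} (z_j - z_k) ∏_i z_i^{(α-1)/2} (q z_i;q)_{(β-1)/2}`. -/
def aomotoIntegrand (α β q : ℝ) {N : ℕ} (z : Fin N → ℝ) : ℝ :=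
  (∏ j, ∏ k ∈ Finset.Ioi j, (z j - z k)) *
    ∏ i, (z i ^ ((α - 1) / 2) * qPochReal (q * z i) q ((β - 1) / 2))

end

/-! Put b = q^{1/2}, A = b^{α+1}, B = b^{β+1}. The variables y and x run over even and odd powers of
b, so up to a positive constant ⟨f, g⟩ is a sum over pairs of an even index and a larger odd index,
with a lattice weight ρ satisfying ρ(m+2)(1 - b^{m+2}) = A(1 - B b^m)ρ(m). The first order operator
D = `raiseOp` is made so that ρ·Dg is a difference with step two on this lattice. One of the two
summations then telescopes, the even and odd halves of the other recombine, and ⟨f, Dg⟩ = -(f, g)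
(`skewForm_raiseOp`), where (f, g) has the little q-Jacobi weight ρ(m)ρ(m+1)(1 - b^{m+1}).

As ⟨·,·⟩ is skew, D is skew-adjoint for (·,·). It raises the degree by one, so D p_n involves only
p_{n+1} and p_{n-1} (`raiseOp_littleJacobi_succ`); comparing constant terms yields the coefficients
and the ratios of consecutive norms. Take Q_{2j} = p_{2j} and Q_{2j+1} proportional to D p_{2j}.
Then ⟨p_{2i}, D p_{2j}⟩ = -(p_{2i}, p_{2j}); D p_{2j} contains only odd p_k, hence ⟨Q_{2i+1},
Q_{2j+1}⟩ = 0; and ⟨p_{2i}, p_{2j}⟩ = 0 by induction, since p_{2j+2} is a multiple of p_{2j} modulo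
D p_{2j+1}. Uniqueness rests on nondegeneracy in degrees below 2j (`eq_zero_of_skewForm`). Part (b)
solves the two-term recursion of part (a).

For (c), the difference product is det Q_j(z_i) up to sign, and the integral runs over increasing
chains of lattice indices of alternating parity. In the exterior algebra the sum of 2n-fold products
over such chains is the n-th power of the sum of 2-fold ones, divided by n!
(`factorial_mul_chainSum`). Skew orthogonality makes this 2-form diagonal, so the integral is a
product of skew norms (`tsum_det_chain`). The zeroth norm comes from the q-binomial theorem. -/

noncomputable section

open Filter Topology

/-! ### Sums over alternating chains -/

/-- The lattice index `2 (μ_0 + ⋯ + μ_i) + i`. -/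
def chainIndex {N : ℕ} (μ : Fin N → ℕ) (i : Fin N) : ℕ :=
  2 * ∑ k ∈ Finset.Iic i, μ k + i

theorem sum_Iic_eq_sum_ite {N : ℕ} (f : Fin N → ℕ) (i : Fin N) :
    ∑ k ∈ Finset.Iic i, f k = ∑ k, if k ≤ i then f k else 0 := by
  rw [← Finset.sum_filter]
  congr 1
  ext k
  simp

theorem chainIndex_cons_zero {N : ℕ} (a : ℕ) (μ : Fin N → ℕ) :
    chainIndex (Fin.cons a μ : Fin (N + 1) → ℕ) 0 = 2 * a := by
  rw [chainIndex, sum_Iic_eq_sum_ite, Fin.sum_univ_succ]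
  simp

theorem chainIndex_cons_succ {N : ℕ} (a : ℕ) (μ : Fin N → ℕ) (i : Fin N) :
    chainIndex (Fin.cons a μ : Fin (N + 1) → ℕ) i.succ = 2 * a + 1 + chainIndex μ i := by
  rw [chainIndex, chainIndex, sum_Iic_eq_sum_ite, sum_Iic_eq_sum_ite, Fin.sum_univ_succ]
  simp
  ring

/-- Chains thus form a subfamily of all index tuples, and sums over them inherit summability from
products of one-variable series. -/
theorem chainIndex_injective {N : ℕ} :
    Function.Injective (chainIndex : (Fin N → ℕ) → Fin N → ℕ) := by
  induction N with
  | zero => exact fun _ _ _ => Subsingleton.elim _ _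
  | succ N ih =>
    intro μ ν h
    obtain ⟨a, μ, rfl⟩ : ∃ a μ', μ = Fin.cons a μ' := ⟨μ 0, Fin.tail μ, (Fin.cons_self_tail μ).symm⟩
    obtain ⟨c, ν, rfl⟩ : ∃ a μ', ν = Fin.cons a μ' := ⟨ν 0, Fin.tail ν, (Fin.cons_self_tail ν).symm⟩
    have h0 := congrFun h 0
    rw [chainIndex_cons_zero, chainIndex_cons_zero] at h0
    obtain rfl : a = c := by omega
    have : μ = ν := ih (funext fun i => by
      have := congrFun h i.succ
      rw [chainIndex_cons_succ, chainIndex_cons_succ] at this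
      omega)
    rw [this]

theorem le_chainIndex {N : ℕ} (μ : Fin N → ℕ) (i : Fin N) : μ i ≤ chainIndex μ i := by
  have : μ i ≤ ∑ k ∈ Finset.Iic i, μ k :=
    Finset.single_le_sum (fun _ _ => Nat.zero_le _) (by simp)
  rw [chainIndex]
  omega

theorem summable_pi_prod {N : ℕ} (f : Fin N → ℕ → ℝ) (hf : ∀ i, Summable (f i)) :
    Summable fun μ : Fin N → ℕ => ∏ i, f i (μ i) := by
  induction N with
  | zero => exact (hasSum_fintype _).summable
  | succ N ih =>
    rw [← (Fin.consEquiv (fun _ => ℕ)).summable_iff]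
    have := summable_mul_of_summable_norm (hf 0).norm (ih (fun i => f i.succ) fun i => hf _).norm
    refine this.congr fun x => ?_
    simp [Fin.consEquiv, Fin.prod_univ_succ]

/-! ### Alternating chains in the exterior algebra -/

namespace ExteriorAlgebra

variable {V : Type*} [AddCommGroup V] [Module ℝ V]

theorem ι_mul_comm_neg (x y : V) : ι ℝ x * ι ℝ y = -(ι ℝ y * ι ℝ x) :=
  eq_neg_of_add_eq_zero_left (ι_add_mul_swap x y)

theorem commute_ι_mul_ι (x y z : V) : Commute (ι ℝ x * ι ℝ y) (ι ℝ z) := by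
  rw [Commute, SemiconjBy, mul_assoc, ι_mul_comm_neg y z, mul_neg, ← mul_assoc,
    ι_mul_comm_neg x z, neg_mul, neg_neg, mul_assoc]

theorem ι_mul_ι_sq (x y : V) : (ι ℝ x * ι ℝ y) * (ι ℝ x * ι ℝ y) = 0 := by
  rw [← mul_assoc, (commute_ι_mul_ι x y x).eq, ← mul_assoc, ι_sq_zero]
  simp

/-- Only terms of degree at most one in `x` survive in the binomial expansion. -/
theorem add_pow_succ_of_sq_zero {R : Type*} [Ring R] {x a : R} (hx : x * x = 0)
    (hc : Commute x a) (k : ℕ) : (x + a) ^ (k + 1) = a ^ (k + 1) + (k + 1) * (x * a ^ k) := by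
  induction k with
  | zero => simp [add_comm]
  | succ k ih =>
    rw [pow_succ', ih]
    have h1 : a * (x * a ^ k) = x * a ^ (k + 1) := by
      rw [← mul_assoc, ← hc.eq, mul_assoc, pow_succ']
    have h2 : x * (x * a ^ k) = 0 := by rw [← mul_assoc, hx, zero_mul]
    have h3 : ∀ y : R, x * ((k + 1) * y) = (k + 1) * (x * y) := fun y => by
      rw [← mul_assoc, ← mul_assoc]; congr 1
      exact_mod_cast ((Nat.cast_commute (k + 1) x).eq).symm
    have h4 : ∀ y : R, a * ((k + 1) * y) = (k + 1) * (a * y) := fun y => by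
      rw [← mul_assoc, ← mul_assoc]; congr 1
      exact_mod_cast ((Nat.cast_commute (k + 1) a).eq).symm
    rw [add_mul, mul_add, mul_add, h3, h4, h1, h2, mul_zero, add_zero, ← pow_succ']
    push_cast
    noncomm_ring

/-- The sum of `c (s + m_0) ∧ ⋯ ∧ c (s + m_{j-1})` over the alternating chains `m` of length `j`
with all gaps less than `K`. -/
def chainSum (K : ℕ) (c : ℕ → V) : ℕ → ℕ → ExteriorAlgebra ℝ V
  | 0, _ => 1
  | j + 1, s => ∑ k ∈ Finset.range K, ι ℝ (c (s + 2 * k)) * chainSum K c j (s + 2 * k + 1)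

theorem chainSum_eq_sum (K : ℕ) (c : ℕ → V) (j s : ℕ) :
    chainSum K c j s = ∑ μ ∈ Fintype.piFinset fun _ : Fin j => Finset.range K,
      ιMulti ℝ j fun i => c (s + chainIndex μ i) := by
  induction j generalizing s with
  | zero => simp [chainSum]
  | succ j ih =>
    rw [chainSum]
    simp_rw [ih, Finset.mul_sum]
    rw [Finset.sum_sigma']
    refine Finset.sum_bij' (fun x _ => (Fin.cons x.1 x.2 : Fin (j + 1) → ℕ))
      (fun μ _ => ⟨μ 0, Fin.tail μ⟩) ?_ ?_ ?_ ?_ ?_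
    · rintro ⟨a, μ⟩ h
      simp only [Finset.mem_sigma, Fintype.mem_piFinset] at h ⊢
      exact Fin.cases h.1 h.2
    · intro μ h
      simp only [Finset.mem_sigma, Fintype.mem_piFinset] at h ⊢
      exact ⟨h _, fun i => h _⟩
    · rintro ⟨a, μ⟩ h
      rfl
    · intro μ h
      exact Fin.cons_self_tail μ
    · rintro ⟨a, μ⟩ h
      rw [ιMulti_apply, ιMulti_apply, List.ofFn_succ, List.prod_cons, chainIndex_cons_zero]
      simp_rw [chainIndex_cons_succ]
      simp only [add_assoc]

variable {K : ℕ} {c : ℕ → V}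

/-- A chain starts at `s`, or at `s + 2` or later. Shifting the start also admits one new starting
point `s + 2 * K`, which contributes nothing because `c` vanishes from `K` on. -/
theorem chainSum_succ_sub (hc : ∀ m, K ≤ m → c m = 0) (j s : ℕ) :
    chainSum K c (j + 1) s = ι ℝ (c s) * chainSum K c j (s + 1) + chainSum K c (j + 1) (s + 2) := by
  rw [chainSum, chainSum]
  have h := Finset.sum_range_succ' (fun k => ι ℝ (c (s + 2 * k)) * chainSum K c j (s + 2 * k + 1)) K
  rw [Finset.sum_range_succ, hc (s + 2 * K) (by omega)] at h
  simp only [map_zero, zero_mul, add_zero, mul_zero] at h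
  rw [h, add_comm]
  congr 1
  refine Finset.sum_congr rfl fun k _ => ?_
  rw [show s + 2 * (k + 1) = s + 2 + 2 * k by ring]

theorem chainSum_eq_zero (hc : ∀ m, K ≤ m → c m = 0) (j s : ℕ) (hs : K ≤ s) :
    chainSum K c (j + 1) s = 0 := by
  rw [chainSum]
  exact Finset.sum_eq_zero fun k _ => by rw [hc _ (by omega)]; simp

theorem chainSum_one (K : ℕ) (c : ℕ → V) (s : ℕ) :
    chainSum K c 1 s = ι ℝ (∑ k ∈ Finset.range K, c (s + 2 * k)) := by
  simp [chainSum]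

theorem chainSum_two (K : ℕ) (c : ℕ → V) (s : ℕ) :
    chainSum K c 2 s = ∑ k ∈ Finset.range K, ι ℝ (c (s + 2 * k)) *
      ι ℝ (∑ l ∈ Finset.range K, c (s + 2 * k + 1 + 2 * l)) := by
  rw [chainSum]
  simp_rw [chainSum_one]

theorem commute_chainSum_two (x : V) (s : ℕ) : Commute (chainSum K c 2 s) (ι ℝ x) := by
  rw [chainSum_two]
  exact Commute.sum_left _ _ _ fun k _ => commute_ι_mul_ι _ _ _

theorem eq_of_backward_recurrence {R : Type*} [AddGroup R] {f g : ℕ → R} (K : ℕ)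
    (hf : ∀ s, K ≤ s → f s = 0) (hg : ∀ s, K ≤ s → g s = 0)
    (h : ∀ s, f (s + 2) = g (s + 2) → f s = g s) (s : ℕ) : f s = g s := by
  by_cases hs : K ≤ s
  · rw [hf s hs, hg s hs]
  · exact h s (eq_of_backward_recurrence K hf hg h (s + 2))
termination_by K - s

/-- Even and odd lengths are treated together, by descending induction on `s` in steps of two.
Splitting off `c s` from a chain of length `2k + 2` leaves an odd chain from `s + 1`. On the other
side, `chainSum K c 2 s` gains a summand that commutes with the rest and squares to zero, so its
power gains just one linear term, and the two increments agree. -/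
theorem factorial_mul_chainSum (hc : ∀ m, K ≤ m → c m = 0) (k : ℕ) : ∀ s,
    (k.factorial : ExteriorAlgebra ℝ V) * chainSum K c (2 * k) s = chainSum K c 2 s ^ k ∧
    (k.factorial : ExteriorAlgebra ℝ V) * chainSum K c (2 * k + 1) s =
      chainSum K c 1 s * chainSum K c 2 (s + 1) ^ k := by
  have hW : ∀ s, chainSum K c 1 s = ι ℝ (c s) + chainSum K c 1 (s + 2) := fun s => by
    rw [chainSum_succ_sub hc 0 s]; simp [chainSum]
  have hA : ∀ s, chainSum K c 2 s = ι ℝ (c s) * chainSum K c 1 (s + 1) + chainSum K c 2 (s + 2) :=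
    fun s => chainSum_succ_sub hc 1 s
  have hcomm : ∀ s x t, Commute (ι ℝ x * chainSum K c 1 s) (chainSum K c 2 t) := fun s x t => by
    rw [chainSum_one]
    exact ((commute_chainSum_two _ _).mul_right (commute_chainSum_two _ _)).symm
  have hsq : ∀ s x, (ι ℝ x * chainSum K c 1 s) * (ι ℝ x * chainSum K c 1 s) = 0 := fun s x => by
    rw [chainSum_one]; exact ι_mul_ι_sq _ _
  have hfact : ∀ (k : ℕ) (x y : ExteriorAlgebra ℝ V),
      (k.factorial : ExteriorAlgebra ℝ V) * (x * y) = x * (k.factorial * y) :=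
    fun k x y => by rw [← mul_assoc, (Nat.cast_commute _ x).eq, mul_assoc]
  -- the odd case follows from the even one
  have hodd : ∀ k, (∀ s, (k.factorial : ExteriorAlgebra ℝ V) * chainSum K c (2 * k) s =
      chainSum K c 2 s ^ k) →
      ∀ s, (k.factorial : ExteriorAlgebra ℝ V) * chainSum K c (2 * k + 1) s =
        chainSum K c 1 s * chainSum K c 2 (s + 1) ^ k := by
    intro k hk
    refine eq_of_backward_recurrence K ?_ ?_ ?_
    · intro s hs; rw [chainSum_eq_zero hc _ _ hs, mul_zero]
    · intro s hs; rw [chainSum_eq_zero hc _ _ hs, zero_mul]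
    · intro s hs
      rw [chainSum_succ_sub hc, mul_add, hs, hfact, hk, hW s, add_mul]
      congr 1
      rcases k with _ | k
      · simp
      rw [hA (s + 1), add_pow_succ_of_sq_zero (hsq _ _) (hcomm _ _ _), mul_add,
        left_eq_add, ← mul_assoc, ← (Nat.cast_add_one (R := ExteriorAlgebra ℝ V) k),
        ← (Nat.cast_commute (k + 1) (chainSum K c 1 (s + 2))).eq, mul_assoc,
        ← mul_assoc (chainSum K c 1 (s + 2))]
      -- The degree one element `chainSum K c 1 (s + 2)` occurs twice in the linear term, which
      -- therefore vanishes.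
      have : chainSum K c 1 (s + 2) * (ι ℝ (c (s + 1)) * chainSum K c 1 (s + 1 + 1)) = 0 := by
        rw [show s + 1 + 1 = s + 2 from rfl, chainSum_one, ← (commute_ι_mul_ι _ _ _).eq,
          mul_assoc, ι_sq_zero, mul_zero]
      rw [this, zero_mul, mul_zero]
  induction k with
  | zero =>
    have h0 : ∀ s, ((Nat.factorial 0 : ℕ) : ExteriorAlgebra ℝ V) * chainSum K c (2 * 0) s =
        chainSum K c 2 s ^ 0 :=
      fun s => by simp [chainSum]
    exact fun s => ⟨h0 s, hodd 0 h0 s⟩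
  | succ k ih =>
    have heven : ∀ s, ((k + 1).factorial : ExteriorAlgebra ℝ V) * chainSum K c (2 * (k + 1)) s =
        chainSum K c 2 s ^ (k + 1) := by
      refine eq_of_backward_recurrence K ?_ ?_ ?_
      · intro s hs
        rw [show 2 * (k + 1) = 2 * k + 1 + 1 by ring, chainSum_eq_zero hc _ _ hs, mul_zero]
      · intro s hs; rw [chainSum_eq_zero hc _ _ hs, pow_succ, mul_zero]
      · intro s hs
        rw [show 2 * (k + 1) = 2 * k + 1 + 1 by ring] at hs ⊢
        rw [chainSum_succ_sub hc, mul_add, hs, hA s,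
          add_pow_succ_of_sq_zero (hsq _ _) (hcomm _ _ _), add_comm]
        congr 1
        rw [Nat.factorial_succ, Nat.cast_mul, mul_assoc, hfact, (ih (s + 1)).2]
        push_cast
        rw [mul_assoc (ι ℝ (c s))]
    exact fun s => ⟨heven s, hodd _ heven s⟩

end ExteriorAlgebra

/-! ### De Bruijn's formula for infinite sums -/

/-- The half-pairing `∑_{k,l} u (2k) v (2k+2l+1)` of two sequences, over pairs consisting of an even
index and a larger odd index. -/
def evenOddSum (u v : ℕ → ℝ) : ℝ :=
  ∑' kl : ℕ × ℕ, u (2 * kl.1) * v (2 * kl.1 + 2 * kl.2 + 1)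

theorem summable_evenOdd {u v : ℕ → ℝ} (hu : Summable u) (hv : Summable v) :
    Summable fun kl : ℕ × ℕ => u (2 * kl.1) * v (2 * kl.1 + 2 * kl.2 + 1) := by
  have h := summable_mul_of_summable_norm hu.norm hv.norm
  have hi : Function.Injective fun kl : ℕ × ℕ => (2 * kl.1, 2 * kl.1 + 2 * kl.2 + 1) := by
    rintro ⟨a, b⟩ ⟨c, d⟩ h
    simp only [Prod.mk.injEq] at h ⊢
    omega
  exact h.comp_injective hi

/-- The expression is a polynomial in the coordinates `x i` with `i ∈ s`, so limits can be taken in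
the coefficients of the 2-form and `R` needs no topology. The extra factor `c` absorbs the last
factor of the power in the induction. -/
theorem continuous_map_sum_smul_pow {ι R : Type*} [Ring R] [Algebra ℝ R] (T : R →ₗ[ℝ] ℝ)
    (s : Finset ι) (a : ι → R) (n : ℕ) (c : R) :
    Continuous fun x : ι → ℝ => T ((∑ i ∈ s, x i • a i) ^ n * c) := by
  induction n generalizing c with
  | zero => simpa using continuous_const
  | succ n ih =>
    have : (fun x : ι → ℝ => T ((∑ i ∈ s, x i • a i) ^ (n + 1) * c)) =
        fun x => ∑ i ∈ s, x i * T ((∑ i ∈ s, x i • a i) ^ n * (a i * c)) := by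
      funext x
      rw [pow_succ, mul_assoc, Finset.sum_mul, Finset.mul_sum, map_sum]
      refine Finset.sum_congr rfl fun i _ => ?_
      rw [smul_mul_assoc, mul_smul_comm, map_smul, smul_eq_mul]
    rw [this]
    exact continuous_finsetSum _ fun i _ => (continuous_apply i).mul (ih _)

theorem sum_range_two_mul {M : Type*} [AddCommMonoid M] (f : ℕ → M) (n : ℕ) :
    ∑ i ∈ Finset.range (2 * n), f i = ∑ m ∈ Finset.range n, (f (2 * m) + f (2 * m + 1)) := by
  induction n with
  | zero => simp
  | succ n ih => rw [mul_add, Finset.sum_range_succ, Finset.sum_range_succ, ih,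
      Finset.sum_range_succ, add_assoc]

namespace ExteriorAlgebra

/-- The top degree coefficient on the exterior algebra of `ℝ^N`. -/
def topCoeff (N : ℕ) : ExteriorAlgebra ℝ (Fin N → ℝ) →ₗ[ℝ] ℝ :=
  liftAlternating fun k => if h : k = N then
    AlternatingMap.domDomCongr (finCongr h.symm) Matrix.detRowAlternating else 0

theorem topCoeff_ιMulti {N : ℕ} (v : Fin N → Fin N → ℝ) :
    topCoeff N (ιMulti ℝ N v) = (Matrix.of v).det := by
  rw [topCoeff, liftAlternating_apply_ιMulti, dif_pos rfl]
  rfl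

/-- Only squarefree monomials survive, and the full one arises in `n!` orders. The vanishing of the
next power is carried along because it removes the pure power in the inductive step. -/
theorem sum_pow_of_commute_of_sq_zero {R : Type*} [Ring R] [Algebra ℝ R] (y : ℕ → R) (w : ℕ → ℝ)
    (hsq : ∀ m, y m * y m = 0) (hc : ∀ m k, Commute (y m) (y k)) (n : ℕ) :
    (∑ m ∈ Finset.range n, w m • y m) ^ (n + 1) = 0 ∧
    (∑ m ∈ Finset.range n, w m • y m) ^ n =
      (n.factorial * ∏ m ∈ Finset.range n, w m) • ((List.range n).map y).prod := by
  induction n with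
  | zero => simp
  | succ n ih =>
    have hx : (w n • y n) * (w n • y n) = 0 := by
      rw [smul_mul_smul_comm, hsq, smul_zero]
    have hcomm : Commute (w n • y n) (∑ m ∈ Finset.range n, w m • y m) :=
      Commute.sum_right _ _ _ fun m _ => ((hc n m).smul_left _).smul_right _
    have hadd := add_pow_succ_of_sq_zero hx hcomm
    rw [Finset.sum_range_succ, add_comm]
    constructor
    · rw [hadd, pow_succ, ih.1]; simp
    · rw [hadd, ih.1, zero_add, ih.2, List.range_succ, List.map_append, List.prod_append,
        Finset.prod_range_succ, Nat.factorial_succ]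
      have hl : Commute (y n) ((List.range n).map y).prod :=
        Commute.list_prod_right _ _ fun z hz => by
          obtain ⟨m, _, rfl⟩ := List.mem_map.1 hz
          exact hc n m
      simp only [List.map_cons, List.map_nil, List.prod_cons, List.prod_nil, mul_one]
      rw [smul_mul_smul_comm, hl.eq, ← Nat.cast_add_one, ← nsmul_eq_mul, ← Nat.cast_smul_eq_nsmul ℝ,
        smul_smul]
      congr 1
      push_cast
      ring

end ExteriorAlgebra

open ExteriorAlgebra

theorem abs_det_le_sum_prod {N : ℕ} (M : Matrix (Fin N) (Fin N) ℝ) :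
    |M.det| ≤ ∑ σ : Equiv.Perm (Fin N), ∏ i, |M i (σ i)| := by
  rw [← Matrix.det_transpose, Matrix.det_apply]
  refine (Finset.abs_sum_le_sum_abs _ _).trans (Finset.sum_le_sum fun σ _ => ?_)
  rw [← Finset.abs_prod]
  rcases Int.units_eq_one_or (Equiv.Perm.sign σ) with h | h <;> simp [h]

/-- This bounds the determinants of all truncations of `u` at once, as dominated convergence
requires. -/
theorem summable_chain_bound {N : ℕ} (u : ℕ → ℕ → ℝ) (hu : ∀ i, Summable (u i)) :
    Summable fun μ : Fin N → ℕ => ∑ σ : Equiv.Perm (Fin N), ∏ i, |u (σ i) (chainIndex μ i)| := by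
  refine summable_sum fun σ _ => ?_
  exact (summable_pi_prod (fun i m => |u (σ i) m|) fun i => (hu _).abs).comp_injective
    chainIndex_injective

theorem tendsto_tsum_truncate {ι : Type*} (F : ι → ℝ) (bound : ι → ℝ) (hb : Summable bound)
    (G : ℕ → ι → ℝ) (hG : ∀ i, ∀ᶠ K in atTop, G K i = F i) (hle : ∀ K i, |G K i| ≤ bound i) :
    Tendsto (fun K => ∑' i, G K i) atTop (𝓝 (∑' i, F i)) := by
  refine tendsto_tsum_of_dominated_convergence hb (fun i => ?_) (Eventually.of_forall fun K i => ?_)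
  · exact tendsto_const_nhds.congr' ((hG i).mono fun K h => h.symm)
  · exact hle K i

theorem summable_det_chain {N : ℕ} (u : ℕ → ℕ → ℝ) (hu : ∀ i, Summable (u i)) :
    Summable fun μ : Fin N → ℕ =>
      (Matrix.of fun i j : Fin N => u j (chainIndex μ i)).det :=
  Summable.of_norm_bounded (summable_chain_bound u hu) fun _ => abs_det_le_sum_prod _

/-- de Bruijn's formula for sums over alternating chains, in terms of the top degree coefficient. -/
theorem tsum_det_chain_eq_topCoeff (n : ℕ) (u : ℕ → ℕ → ℝ) (hu : ∀ i, Summable (u i))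
    (θ : ℕ → Fin (2 * n) → ℝ) (hθ : θ = fun i (j : Fin (2 * n)) => if (j : ℕ) = i then 1 else 0) :
    n.factorial * ∑' μ : Fin (2 * n) → ℕ,
        (Matrix.of fun i j : Fin (2 * n) => u j (chainIndex μ i)).det =
      topCoeff (2 * n) ((∑ p ∈ Finset.range (2 * n) ×ˢ Finset.range (2 * n),
        evenOddSum (u p.1) (u p.2) • (ι ℝ (θ p.1) * ι ℝ (θ p.2))) ^ n) := by
  -- Truncated sequences have finite chain sums, to which the exterior algebra identity applies. The
  -- cutoff `K` then tends to infinity on both sides, by dominated convergence.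
  let t : ℕ → ℕ → ℕ → ℝ := fun K i m => if m < K then u i m else 0
  have ht : ∀ i m, ∀ᶠ K in atTop, t K i m = u i m := fun i m =>
    (eventually_gt_atTop m).mono fun K h => if_pos h
  have hle : ∀ K i m, |t K i m| ≤ |u i m| := fun K i m => by
    simp only [t]; split_ifs
    · exact le_rfl
    · simp
  let c : ℕ → ℕ → Fin (2 * n) → ℝ := fun K m j => t K j m
  have hc0 : ∀ K m, K ≤ m → c K m = 0 := fun K m h => by
    funext j; exact if_neg (by omega)
  have hcθ : ∀ K m, c K m = ∑ i ∈ Finset.range (2 * n), t K i m • θ i := fun K m => by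
    funext j
    simp [c, hθ]
  have h1 : Tendsto (fun K => ∑' μ : Fin (2 * n) → ℕ,
      (Matrix.of fun i => c K (chainIndex μ i)).det) atTop
      (𝓝 (∑' μ : Fin (2 * n) → ℕ,
        (Matrix.of fun i j : Fin (2 * n) => u j (chainIndex μ i)).det)) := by
    refine tendsto_tsum_truncate _ _ (summable_chain_bound u hu) _ (fun μ => ?_) (fun K μ => ?_)
    · have : ∀ᶠ K in atTop, ∀ i j : Fin (2 * n), t K j (chainIndex μ i) = u j (chainIndex μ i) :=
        eventually_all.2 fun i => eventually_all.2 fun j => ht _ _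
      refine this.mono fun K h => ?_
      congr 1
      ext i j
      exact h i j
    · refine (abs_det_le_sum_prod _).trans (Finset.sum_le_sum fun σ _ => ?_)
      exact Finset.prod_le_prod (fun _ _ => abs_nonneg _) fun i _ => hle _ _ _
  have h2 : ∀ K, ∑' μ : Fin (2 * n) → ℕ, (Matrix.of fun i => c K (chainIndex μ i)).det =
      topCoeff (2 * n) (chainSum K (c K) (2 * n) 0) := by
    intro K
    rw [chainSum_eq_sum, map_sum]
    simp_rw [topCoeff_ιMulti, zero_add]
    refine tsum_eq_sum fun μ hμ => ?_
    simp only [Fintype.mem_piFinset, Finset.mem_range, not_forall, not_lt] at hμ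
    obtain ⟨i, hi⟩ := hμ
    refine Matrix.det_eq_zero_of_row_eq_zero i fun j => ?_
    have := hc0 K _ (hi.trans (le_chainIndex μ i))
    exact congrFun this j
  let E : ℕ → ℕ × ℕ → ℝ := fun K p => ∑' kl : ℕ × ℕ,
    t K p.1 (2 * kl.1) * t K p.2 (2 * kl.1 + 2 * kl.2 + 1)
  have h3 : Tendsto E atTop (𝓝 fun p => evenOddSum (u p.1) (u p.2)) := by
    rw [tendsto_pi_nhds]
    intro p
    refine tendsto_tsum_truncate _ _ (summable_evenOdd (hu p.1).abs (hu p.2).abs) _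
      (fun kl => ?_) (fun K kl => ?_)
    · filter_upwards [ht p.1 (2 * kl.1), ht p.2 (2 * kl.1 + 2 * kl.2 + 1)] with K h h'
      rw [h, h']
    · rw [abs_mul]
      exact mul_le_mul (hle _ _ _) (hle _ _ _) (abs_nonneg _) (abs_nonneg _)
  have h4 : ∀ K, chainSum K (c K) 2 0 = ∑ p ∈ Finset.range (2 * n) ×ˢ Finset.range (2 * n),
      E K p • (ι ℝ (θ p.1) * ι ℝ (θ p.2)) := by
    intro K
    have hE : ∀ p, E K p = ∑ kl ∈ Finset.range K ×ˢ Finset.range K,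
        t K p.1 (2 * kl.1) * t K p.2 (2 * kl.1 + 2 * kl.2 + 1) := fun p => by
      refine tsum_eq_sum fun kl hkl => ?_
      simp only [Finset.mem_product, Finset.mem_range, not_and_or, not_lt] at hkl
      rcases hkl with h | h
      · simp only [t]; rw [if_neg (by omega), zero_mul]
      · simp only [t]; rw [if_neg (c := 2 * kl.1 + 2 * kl.2 + 1 < K) (by omega), mul_zero]
    simp_rw [hE, Finset.sum_smul]
    rw [Finset.sum_comm, Finset.sum_product, chainSum_two]
    refine Finset.sum_congr rfl fun k _ => ?_
    rw [map_sum, Finset.mul_sum]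
    refine Finset.sum_congr rfl fun l _ => ?_
    rw [hcθ, hcθ, map_sum, map_sum, Finset.sum_mul_sum, Finset.sum_product]
    refine Finset.sum_congr rfl fun i _ => Finset.sum_congr rfl fun j _ => ?_
    rw [map_smul, map_smul, smul_mul_smul_comm, zero_add,
      show 2 * k + 1 + 2 * l = 2 * k + 2 * l + 1 by ring]
  have h5 := ((continuous_map_sum_smul_pow (topCoeff (2 * n))
    (Finset.range (2 * n) ×ˢ Finset.range (2 * n))
    (fun p => ι ℝ (θ p.1) * ι ℝ (θ p.2)) n 1).tendsto _).comp h3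
  simp only [mul_one] at h5
  refine tendsto_nhds_unique (h1.const_mul _) (h5.congr fun K => ?_)
  simp only [Function.comp]
  rw [h2, ← h4, ← (factorial_mul_chainSum (hc0 K) n 0).1, ← nsmul_eq_mul, map_nsmul, nsmul_eq_mul]

/-- Under these relations the 2-form is `∑ w m • θ (2m) ∧ θ (2m+1)`, whose `n`-th power is `n! ∏ w
m` times the volume form. This is the Pfaffian of a block diagonal matrix. -/
theorem tsum_det_chain (n : ℕ) (u : ℕ → ℕ → ℝ) (hu : ∀ i, Summable (u i)) (w : ℕ → ℝ)
    (hee : ∀ m k, evenOddSum (u (2 * m)) (u (2 * k)) - evenOddSum (u (2 * k)) (u (2 * m)) = 0)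
    (hoo : ∀ m k, evenOddSum (u (2 * m + 1)) (u (2 * k + 1)) -
      evenOddSum (u (2 * k + 1)) (u (2 * m + 1)) = 0)
    (heo : ∀ m k, evenOddSum (u (2 * m)) (u (2 * k + 1)) -
      evenOddSum (u (2 * k + 1)) (u (2 * m)) = if m = k then w m else 0) :
    ∑' μ : Fin (2 * n) → ℕ, (Matrix.of fun i j : Fin (2 * n) => u j (chainIndex μ i)).det =
      ∏ m ∈ Finset.range n, w m := by
  obtain ⟨θ, hθ⟩ : ∃ θ : ℕ → Fin (2 * n) → ℝ, θ = fun i (j : Fin (2 * n)) => if (j : ℕ) = i then 1 else 0 :=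
    ⟨_, rfl⟩
  have h := tsum_det_chain_eq_topCoeff n u hu θ hθ
  set E : ℕ → ℕ → ℝ := fun i j => evenOddSum (u i) (u j) with hE
  let y : ℕ → ExteriorAlgebra ℝ (Fin (2 * n) → ℝ) := fun m => ι ℝ (θ (2 * m)) * ι ℝ (θ (2 * m + 1))
  have hA : ∑ p ∈ Finset.range (2 * n) ×ˢ Finset.range (2 * n),
      E p.1 p.2 • (ι ℝ (θ p.1) * ι ℝ (θ p.2)) = ∑ m ∈ Finset.range n, w m • y m := by
    -- The hypotheses concern only the antisymmetric part of `E`, and the wedge product sees only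
    -- that part; doubling exhibits it.
    have hdouble : (2 : ℝ) • ∑ p ∈ Finset.range (2 * n) ×ˢ Finset.range (2 * n),
        E p.1 p.2 • (ι ℝ (θ p.1) * ι ℝ (θ p.2)) =
        ∑ i ∈ Finset.range (2 * n), ∑ j ∈ Finset.range (2 * n),
          (E i j - E j i) • (ι ℝ (θ i) * ι ℝ (θ j)) := by
      simp_rw [sub_smul, Finset.sum_sub_distrib]
      rw [two_smul, Finset.sum_product, sub_eq_add_neg]
      congr 1
      rw [Finset.sum_comm, ← Finset.sum_neg_distrib]
      refine Finset.sum_congr rfl fun i _ => ?_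
      rw [← Finset.sum_neg_distrib]
      refine Finset.sum_congr rfl fun j _ => ?_
      rw [ι_mul_comm_neg (θ j) (θ i), smul_neg]
    have hoe : ∀ m k, E (2 * m + 1) (2 * k) - E (2 * k) (2 * m + 1) = if m = k then -w m else 0 := by
      intro m k
      have := heo k m
      rw [← neg_sub, this]
      by_cases hmk : m = k
      · simp [hmk]
      · simp [hmk, Ne.symm hmk]
    have hfin : ∑ i ∈ Finset.range (2 * n), ∑ j ∈ Finset.range (2 * n),
          (E i j - E j i) • (ι ℝ (θ i) * ι ℝ (θ j)) =
        (2 : ℝ) • ∑ m ∈ Finset.range n, w m • y m := by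
      rw [sum_range_two_mul, Finset.smul_sum]
      refine Finset.sum_congr rfl fun m hm => ?_
      rw [sum_range_two_mul, sum_range_two_mul]
      simp only [hE] at hoe ⊢
      simp only [hee, hoo, heo, hoe, zero_smul, zero_add, add_zero, ite_smul, neg_smul]
      rw [Finset.sum_ite_eq, Finset.sum_ite_eq, if_pos hm, if_pos hm, ← smul_neg,
        ← ι_mul_comm_neg, two_smul]
    have := hdouble.trans hfin
    exact smul_right_injective _ (two_ne_zero' ℝ) this
  have hlist : ((List.range n).map y).prod = ιMulti ℝ (2 * n) fun i => θ i := by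
    rw [ιMulti_apply]
    have h1 : ∀ N : ℕ, (List.ofFn fun i : Fin N => ι ℝ (θ i)) =
        (List.range N).map fun i => ι ℝ (θ i) := fun N => by
      rw [← List.map_coe_finRange_eq_range, List.map_map, List.ofFn_eq_map]
      rfl
    rw [h1]
    have : ∀ N, ((List.range N).map y).prod = ((List.range (2 * N)).map fun i => ι ℝ (θ i)).prod := by
      intro N
      induction N with
      | zero => simp
      | succ N ih =>
        rw [mul_add, List.range_succ, List.range_succ, List.range_succ]
        simp only [List.map_append, List.prod_append, ih]
        simp [y, mul_assoc]
    exact this n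
  have hone : topCoeff (2 * n) (ιMulti ℝ (2 * n) fun i => θ i) = 1 := by
    rw [topCoeff_ιMulti, ← Matrix.det_one (n := Fin (2 * n)) (R := ℝ)]
    congr 1
    ext i j
    simp [hθ, Matrix.one_apply, Fin.ext_iff, eq_comm]
  rw [hA, (sum_pow_of_commute_of_sq_zero y w (fun m => ι_mul_ι_sq _ _)
    (fun m k => (commute_ι_mul_ι _ _ _).mul_right (commute_ι_mul_ι _ _ _)) n).2, hlist,
    map_smul, hone, smul_eq_mul, mul_one] at h
  exact mul_left_cancel₀ (by exact_mod_cast n.factorial_ne_zero) h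

/-! ### Telescoping of the half-pairing -/

theorem evenOddSum_of_telescoping {u v G : ℕ → ℝ} (hu : Summable u) (hv : Summable v)
    (hG : Tendsto G atTop (𝓝 0)) (hvG : ∀ m, v (m + 1) = G m - G (m + 2)) :
    evenOddSum u v = ∑' k, u (2 * k) * G (2 * k) := by
  have hs := summable_evenOdd hu hv
  rw [evenOddSum, hs.tsum_prod]
  refine tsum_congr fun k => ?_
  change ∑' l, u (2 * k) * v (2 * k + 2 * l + 1) = _
  rw [tsum_mul_left]
  congr 1
  refine HasSum.tsum_eq ?_
  have hsv : Summable fun l => v (2 * k + 2 * l + 1) :=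
    hv.comp_injective fun a b h => by grind
  rw [hsv.hasSum_iff_tendsto_nat]
  have hsum : ∀ n, ∑ l ∈ Finset.range n, v (2 * k + 2 * l + 1) = G (2 * k) - G (2 * k + 2 * n) := by
    intro n
    induction n with
    | zero => simp
    | succ n ih => rw [Finset.sum_range_succ, ih, hvG]; ring_nf
  simp_rw [hsum]
  have : Tendsto (fun n => G (2 * k + 2 * n)) atTop (𝓝 0) :=
    hG.comp (tendsto_atTop_mono (fun n => by simp only [id]; omega) tendsto_id)
  simpa using tendsto_const_nhds.sub this

/-- Here the telescoping sequence carries the smaller index, so the double sum is regrouped by the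
larger one, `2j + 1`. The finite inner sum over even indices up to `2j` telescopes down to the
boundary value `v 0`. -/
theorem evenOddSum_of_telescoping' {u v G : ℕ → ℝ} (hu : Summable u) (hv : Summable v)
    (hv0 : v 0 = -G 1) (hvG : ∀ m, v (m + 1) = G m - G (m + 2)) :
    evenOddSum v u = -∑' j, u (2 * j + 1) * G (2 * j + 1) := by
  have hs := summable_evenOdd hv hu
  have hsig := (Finset.HasAntidiagonal.sigmaAntidiagonalEquivProd (A := ℕ)).summable_iff.2 hs
  rw [evenOddSum, ← (Finset.HasAntidiagonal.sigmaAntidiagonalEquivProd (A := ℕ)).tsum_eq, ← tsum_neg]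
  refine hsig.tsum_sigma.trans ?_
  refine tsum_congr fun j => ?_
  rw [tsum_fintype]
  refine (Finset.sum_coe_sort (Finset.HasAntidiagonal.antidiagonal j)
    fun kl : ℕ × ℕ => v (2 * kl.1) * u (2 * kl.1 + 2 * kl.2 + 1)).trans ?_
  have h1 : ∀ kl ∈ Finset.HasAntidiagonal.antidiagonal j,
      v (2 * kl.1) * u (2 * kl.1 + 2 * kl.2 + 1) = v (2 * kl.1) * u (2 * j + 1) := fun kl h => by
    rw [← Finset.HasAntidiagonal.mem_antidiagonal.1 h, mul_add]
  rw [Finset.sum_congr rfl h1, ← Finset.sum_mul,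
    Finset.Nat.sum_antidiagonal_eq_sum_range_succ (fun k _ => v (2 * k))]
  have h2 : ∀ n, ∑ k ∈ Finset.range (n + 1), v (2 * k) = -G (2 * n + 1) := by
    intro n
    induction n with
    | zero => simp [hv0]
    | succ n ih =>
      rw [Finset.sum_range_succ, ih, mul_add, hvG (2 * n + 1)]
      ring_nf
  rw [h2]
  ring

theorem summable_mul_of_summable {u v : ℕ → ℝ} (hu : Summable u) (hv : Summable v) :
    Summable fun m => u m * v m :=
  (summable_mul_of_summable_norm hu.norm hv.norm).comp_injective (i := fun m : ℕ => (m, m))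
    fun _ _ h => (Prod.mk.inj h).1

/-- One half-pairing yields the even terms, the other the odd terms, and together they form a single
sum over the whole lattice. -/
theorem evenOddSum_sub_of_telescoping {u v G : ℕ → ℝ} (hu : Summable u) (hv : Summable v)
    (hG : Summable G) (hv0 : v 0 = -G 1) (hvG : ∀ m, v (m + 1) = G m - G (m + 2)) :
    evenOddSum u v - evenOddSum v u = ∑' m, u m * G m := by
  have hs : Summable fun m => u m * G m := summable_mul_of_summable hu hG
  have he : Summable fun m => u (2 * m) * G (2 * m) :=
    hs.comp_injective (i := fun m => 2 * m) fun a b h => by simpa using h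
  have ho : Summable fun m => u (2 * m + 1) * G (2 * m + 1) :=
    hs.comp_injective (i := fun m => 2 * m + 1) fun a b h => by simpa using h
  rw [evenOddSum_of_telescoping hu hv hG.tendsto_atTop_zero hvG,
    evenOddSum_of_telescoping' hu hv hv0 hvG, sub_neg_eq_add]
  exact tsum_even_add_odd (f := fun m => u m * G m) he ho

theorem evenOddSum_add_left {u u' v : ℕ → ℝ} (hu : Summable u) (hu' : Summable u')
    (hv : Summable v) : evenOddSum (fun m => u m + u' m) v = evenOddSum u v + evenOddSum u' v := by
  rw [evenOddSum, evenOddSum, evenOddSum, ← (summable_evenOdd hu hv).tsum_add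
    (summable_evenOdd hu' hv)]
  simp_rw [add_mul]

theorem evenOddSum_add_right {u v v' : ℕ → ℝ} (hu : Summable u) (hv : Summable v)
    (hv' : Summable v') : evenOddSum u (fun m => v m + v' m) = evenOddSum u v + evenOddSum u v' := by
  rw [evenOddSum, evenOddSum, evenOddSum, ← (summable_evenOdd hu hv).tsum_add
    (summable_evenOdd hu hv')]
  simp_rw [mul_add]

theorem evenOddSum_smul_left (c : ℝ) (u v : ℕ → ℝ) :
    evenOddSum (fun m => c * u m) v = c * evenOddSum u v := by
  rw [evenOddSum, evenOddSum, ← tsum_mul_left]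
  simp_rw [mul_assoc]

theorem evenOddSum_smul_right (c : ℝ) (u v : ℕ → ℝ) :
    evenOddSum u (fun m => c * v m) = c * evenOddSum u v := by
  rw [evenOddSum, evenOddSum, ← tsum_mul_left]
  simp_rw [mul_left_comm]

/-! ### q-shifted factorials and the q-binomial theorem -/

section

variable {a b z : ℝ}

theorem qPoch_succ (a b : ℝ) (n : ℕ) : qPoch a b (n + 1) = qPoch a b n * (1 - a * b ^ n) :=
  Finset.prod_range_succ _ _

theorem qPoch_succ' (a b : ℝ) (n : ℕ) : qPoch a b (n + 1) = (1 - a) * qPoch (a * b) b n := by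
  rw [qPoch, Finset.prod_range_succ', mul_comm, qPoch]
  simp [pow_succ', mul_assoc]

theorem qPoch_add (a b : ℝ) (m n : ℕ) :
    qPoch a b (m + n) = qPoch a b m * qPoch (a * b ^ m) b n := by
  rw [qPoch, Finset.prod_range_add]
  simp [qPoch, pow_add, mul_assoc]

theorem mul_pow_lt_one (ha : a < 1) (hb0 : 0 ≤ b) (hb1 : b < 1) (k : ℕ) : a * b ^ k < 1 := by
  have h1 : b ^ k ≤ 1 := pow_le_one₀ hb0 hb1.le
  have h0 : 0 ≤ b ^ k := by positivity
  rcases le_total a 0 with h | h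
  · linarith [mul_nonpos_of_nonpos_of_nonneg h h0]
  · exact (mul_le_of_le_one_right h h1).trans_lt ha

theorem qPoch_pos (ha : a < 1) (hb0 : 0 ≤ b) (hb1 : b < 1) (n : ℕ) : 0 < qPoch a b n := by
  refine Finset.prod_pos fun k _ => ?_
  linarith [mul_pow_lt_one ha hb0 hb1 k]

theorem summable_mul_pow (a : ℝ) (hb0 : 0 ≤ b) (hb1 : b < 1) : Summable fun k : ℕ => -(a * b ^ k) :=
  ((summable_geometric_of_lt_one hb0 hb1).mul_left a).neg

theorem multipliable_qPochInf (a : ℝ) (hb0 : 0 ≤ b) (hb1 : b < 1) :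
    Multipliable fun k : ℕ => 1 - a * b ^ k := by
  simpa [sub_eq_add_neg] using Real.multipliable_one_add_of_summable (summable_mul_pow a hb0 hb1)

theorem tendsto_qPoch (a : ℝ) (hb0 : 0 ≤ b) (hb1 : b < 1) :
    Tendsto (qPoch a b) atTop (𝓝 (qPochInf a b)) :=
  (multipliable_qPochInf a hb0 hb1).hasProd.tendsto_prod_nat

theorem qPochInf_eq_qPoch_mul (a : ℝ) (hb0 : 0 ≤ b) (hb1 : b < 1) (n : ℕ) :
    qPochInf a b = qPoch a b n * qPochInf (a * b ^ n) b := by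
  refine tendsto_nhds_unique ((tendsto_add_atTop_iff_nat n).2 (tendsto_qPoch a hb0 hb1)) ?_
  refine ((tendsto_qPoch (a * b ^ n) hb0 hb1).const_mul (qPoch a b n)).congr fun m => ?_
  rw [← qPoch_add, add_comm]

theorem qPochInf_eq_mul (a : ℝ) (hb0 : 0 ≤ b) (hb1 : b < 1) :
    qPochInf a b = (1 - a) * qPochInf (a * b) b := by
  simpa [qPoch] using qPochInf_eq_qPoch_mul a hb0 hb1 1

theorem qPochInf_ne_zero (hb0 : 0 ≤ b) (hb1 : b < 1) (h : ∀ k : ℕ, a * b ^ k ≠ 1) :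
    qPochInf a b ≠ 0 := by
  have := tprod_one_add_ne_zero_of_summable (R := ℝ) (f := fun k : ℕ => -(a * b ^ k))
    (fun k => by
      have := h k
      rw [← sub_eq_add_neg]
      exact sub_ne_zero.2 this.symm) (summable_mul_pow a hb0 hb1).norm
  simpa [qPochInf, sub_eq_add_neg] using this

theorem qPochInf_nonneg (ha : a < 1) (hb0 : 0 ≤ b) (hb1 : b < 1) : 0 ≤ qPochInf a b :=
  ge_of_tendsto' (tendsto_qPoch a hb0 hb1) fun n => (qPoch_pos ha hb0 hb1 n).le

theorem qPochInf_pos (ha : a < 1) (hb0 : 0 ≤ b) (hb1 : b < 1) : 0 < qPochInf a b :=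
  (qPochInf_nonneg ha hb0 hb1).lt_of_ne'
    (qPochInf_ne_zero hb0 hb1 fun k => (mul_pow_lt_one ha hb0 hb1 k).ne)

theorem qPoch_anti {a a' : ℝ} (h : a ≤ a') (ha' : a' < 1) (hb0 : 0 ≤ b) (hb1 : b < 1) (n : ℕ) :
    qPoch a' b n ≤ qPoch a b n := by
  refine Finset.prod_le_prod (fun k _ => ?_) fun k _ => ?_
  · have := mul_pow_lt_one ha' hb0 hb1 k
    linarith
  · have : 0 ≤ b ^ k := by positivity
    nlinarith

theorem qPochInf_anti {a a' : ℝ} (h : a ≤ a') (ha' : a' < 1) (hb0 : 0 ≤ b) (hb1 : b < 1) :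
    qPochInf a' b ≤ qPochInf a b :=
  le_of_tendsto_of_tendsto' (tendsto_qPoch a' hb0 hb1) (tendsto_qPoch a hb0 hb1)
    (qPoch_anti h ha' hb0 hb1)

theorem qPochInf_zero (b : ℝ) : qPochInf 0 b = 1 := by simp [qPochInf]

theorem qPochInf_le_one (ha0 : 0 ≤ a) (ha : a < 1) (hb0 : 0 ≤ b) (hb1 : b < 1) :
    qPochInf a b ≤ 1 :=
  (qPochInf_anti ha0 ha hb0 hb1).trans_eq (qPochInf_zero b)

/-- Splitting an infinite product in base `b` into its even and odd factors. -/
theorem qPochInf_sq_mul (a : ℝ) (hb0 : 0 ≤ b) (hb1 : b < 1) :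
    qPochInf a (b ^ 2) * qPochInf (a * b) (b ^ 2) = qPochInf a b := by
  have h2 : b ^ 2 < 1 := pow_lt_one₀ hb0 hb1 two_ne_zero
  have h : ∀ n, qPoch a b (2 * n) = qPoch a (b ^ 2) n * qPoch (a * b) (b ^ 2) n := by
    intro n
    induction n with
    | zero => simp [qPoch]
    | succ n ih =>
      rw [mul_add, qPoch_succ, qPoch_succ, ih, qPoch_succ, qPoch_succ, ← pow_mul]
      ring
  have h3 : Tendsto (fun n : ℕ => 2 * n) atTop atTop :=
    tendsto_atTop_mono (fun n => by simp only [id]; omega) tendsto_id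
  refine tendsto_nhds_unique ?_ ((tendsto_qPoch a hb0 hb1).comp h3)
  simp only [Function.comp_def, h]
  exact (tendsto_qPoch a (by positivity) h2).mul (tendsto_qPoch (a * b) (by positivity) h2)

theorem summable_qBinomial (ha0 : 0 ≤ a) (ha : a < 1) (hb0 : 0 ≤ b) (hb1 : b < 1) (hz0 : 0 ≤ z)
    (hz : z < 1) : Summable fun m : ℕ => qPoch a b m / qPoch b b m * z ^ m := by
  have hpos := qPochInf_pos hb1 hb0 hb1
  refine Summable.of_nonneg_of_le (fun m => ?_) (fun m => ?_)
    ((summable_geometric_of_lt_one hz0 hz).mul_left (1 / qPochInf b b))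
  · have := qPoch_pos ha hb0 hb1 m
    have := qPoch_pos hb1 hb0 hb1 m
    positivity
  · refine mul_le_mul_of_nonneg_right ?_ (by positivity)
    have h1 : qPoch a b m ≤ 1 := by
      simpa [qPoch] using qPoch_anti ha0 ha hb0 hb1 m
    have h2 : qPochInf b b ≤ qPoch b b m := by
      rw [qPochInf_eq_qPoch_mul b hb0 hb1 m]
      refine mul_le_of_le_one_right (qPoch_pos hb1 hb0 hb1 m).le ?_
      exact qPochInf_le_one (by positivity) (mul_pow_lt_one hb1 hb0 hb1 m) hb0 hb1
    exact div_le_div₀ zero_le_one h1 hpos h2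

/-- The two-term recurrence of the coefficients becomes a functional equation between the values at
`z` and `z * b`. -/
theorem qBinomial_step (ha0 : 0 ≤ a) (ha : a < 1) (hb0 : 0 ≤ b) (hb1 : b < 1) (hz0 : 0 ≤ z)
    (hz : z < 1) :
    (1 - z) * ∑' m : ℕ, qPoch a b m / qPoch b b m * z ^ m =
      (1 - a * z) * ∑' m : ℕ, qPoch a b m / qPoch b b m * (z * b) ^ m := by
  have hs := summable_qBinomial ha0 ha hb0 hb1 hz0 hz
  have hs' := summable_qBinomial ha0 ha hb0 hb1 (mul_nonneg hz0 hb0)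
    (by simpa using mul_pow_lt_one hz hb0 hb1 1)
  set c : ℕ → ℝ := fun m => qPoch a b m / qPoch b b m with hc
  have hrec : ∀ m, c (m + 1) * (1 - b ^ (m + 1)) = c m * (1 - a * b ^ m) := fun m => by
    have h1 := (qPoch_pos hb1 hb0 hb1 m).ne'
    have h2 : 1 - b * b ^ m ≠ 0 := (sub_pos.2 (mul_pow_lt_one hb1 hb0 hb1 m)).ne'
    simp only [hc, qPoch_succ]
    rw [pow_succ', mul_div_mul_comm, mul_assoc, mul_comm (_ / (1 - b * b ^ m)),
      div_mul_eq_mul_div, div_mul_eq_mul_div, mul_div_cancel₀ _ h2]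
  have key : ∑' m, c m * z ^ m - ∑' m, c m * (z * b) ^ m =
      z * ∑' m, c m * z ^ m - a * z * ∑' m, c m * (z * b) ^ m := by
    rw [← hs.tsum_sub hs', ← tsum_mul_left, ← tsum_mul_left,
      ← (hs.mul_left z).tsum_sub (hs'.mul_left (a * z)), (hs.sub hs').tsum_eq_zero_add]
    simp only [pow_zero, sub_self, zero_add]
    refine tsum_congr fun m => ?_
    have := hrec m
    rw [mul_pow, mul_pow]
    linear_combination z ^ (m + 1) * this
  linear_combination key

/-- The `q`-binomial theorem. -/
theorem qBinomial (ha0 : 0 ≤ a) (ha : a < 1) (hb0 : 0 ≤ b) (hb1 : b < 1) (hz0 : 0 ≤ z)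
    (hz : z < 1) :
    ∑' m : ℕ, qPoch a b m / qPoch b b m * z ^ m = qPochInf (a * z) b / qPochInf z b := by
  have haz : a * z < 1 := by nlinarith
  have hzb : ∀ n, z * b ^ n < 1 := mul_pow_lt_one hz hb0 hb1
  have hit : ∀ n, qPoch z b n * ∑' m : ℕ, qPoch a b m / qPoch b b m * z ^ m =
      qPoch (a * z) b n * ∑' m : ℕ, qPoch a b m / qPoch b b m * (z * b ^ n) ^ m := by
    intro n
    induction n with
    | zero => simp [qPoch]
    | succ n ih =>
      have := qBinomial_step ha0 ha hb0 hb1 (z := z * b ^ n) (by positivity) (hzb n)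
      rw [qPoch_succ, qPoch_succ, mul_right_comm, ih, mul_right_comm, mul_assoc, mul_comm _ (1 - _),
        this, pow_succ]
      ring_nf
  -- After iterating the functional equation the argument tends to zero, and only the constant term
  -- of the series remains.
  have hlim : Tendsto (fun n => ∑' m : ℕ, qPoch a b m / qPoch b b m * (z * b ^ n) ^ m) atTop
      (𝓝 (∑' m : ℕ, if m = 0 then (1 : ℝ) else 0)) := by
    refine tendsto_tsum_of_dominated_convergence (summable_qBinomial ha0 ha hb0 hb1 hz0 hz)
      (fun m => ?_) (Eventually.of_forall fun n m => ?_)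
    · have hb : Tendsto (fun n : ℕ => z * b ^ n) atTop (𝓝 0) := by
        simpa using (tendsto_pow_atTop_nhds_zero_of_lt_one hb0 hb1).const_mul z
      have := (hb.pow m).const_mul (qPoch a b m / qPoch b b m)
      rcases m with _ | m
      · simp [qPoch]
      · simpa using this
    · have h1 := qPoch_pos ha hb0 hb1 m
      have h2 := qPoch_pos hb1 hb0 hb1 m
      have h3 : z * b ^ n ≤ z := mul_le_of_le_one_right hz0 (pow_le_one₀ hb0 hb1.le)
      rw [Real.norm_of_nonneg (by positivity)]
      gcongr
  rw [tsum_ite_eq] at hlim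
  have := tendsto_nhds_unique ((tendsto_qPoch z hb0 hb1).mul_const _)
    (((tendsto_qPoch (a * z) hb0 hb1).mul hlim).congr fun n => (hit n).symm)
  rw [eq_div_iff (qPochInf_pos hz hb0 hb1).ne', mul_comm, this, mul_one]

end

/-! ### Lattice weights, the two forms and the difference operators -/

/-- A positive summable weight on the lattice `b^m` whose products of neighbouring values give the
little `q`-Jacobi weight with parameters `A = b^{α+1}`, `B = b^{β+1}`. -/
structure IsLatticeWeight (A B b : ℝ) (ρ : ℕ → ℝ) : Prop where
  b_pos : 0 < b
  b_lt_one : b < 1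
  A_pos : 0 < A
  A_lt_one : A < 1
  B_pos : 0 < B
  B_lt_one : B < 1
  pos : ∀ m, 0 < ρ m
  recurrence : ∀ m, ρ (m + 2) * (1 - b ^ (m + 2)) = A * (1 - B * b ^ m) * ρ m
  summable : Summable ρ

/-- The little `q`-Jacobi weight made from a lattice weight. -/
def jacobiWeight (b : ℝ) (ρ : ℕ → ℝ) (m : ℕ) : ℝ := ρ m * ρ (m + 1) * (1 - b ^ (m + 1))

/-- The first order difference operator which intertwines the skew form and the Jacobi form. -/
def raiseOp (A B b : ℝ) (g : ℝ[X]) : ℝ[X] :=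
  (1 - X) * g.comp (C b⁻¹ * X) - C A * (1 - C B * X) * g.comp (C b * X)

/-- `(p(bx) - p(x)) / x`. -/
def scaledDiff (b : ℝ) (p : ℝ[X]) : ℝ[X] := (p.comp (C b * X) - p).divX

/-- The little `q`-Jacobi difference operator. -/
def jacobiOp (A B b : ℝ) (p : ℝ[X]) : ℝ[X] :=
  C (A / b) * (C B * X - 1) * scaledDiff b p - C b⁻¹ * (X - 1) * (scaledDiff b p).comp (C b⁻¹ * X)

section coefficients

variable {A B b : ℝ}

theorem coeff_raiseOp_zero (g : ℝ[X]) : (raiseOp A B b g).coeff 0 = (1 - A) * g.coeff 0 := by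
  simp only [raiseOp, sub_mul, mul_sub, one_mul, mul_one, coeff_sub, mul_assoc, coeff_C_mul,
    coeff_X_mul_zero, comp_C_mul_X_coeff]
  ring

theorem coeff_raiseOp_succ (g : ℝ[X]) (n : ℕ) : (raiseOp A B b g).coeff (n + 1) =
    g.coeff (n + 1) * b⁻¹ ^ (n + 1) - g.coeff n * b⁻¹ ^ n -
      A * (g.coeff (n + 1) * b ^ (n + 1) - B * (g.coeff n * b ^ n)) := by
  simp only [raiseOp, sub_mul, mul_sub, one_mul, mul_one, coeff_sub, mul_assoc, coeff_C_mul,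
    coeff_X_mul, comp_C_mul_X_coeff]

theorem degree_raiseOp_lt {g : ℝ[X]} {n : ℕ} (hg : g.degree < n) :
    (raiseOp A B b g).degree < (n + 1 : ℕ) := by
  rw [degree_lt_iff_coeff_zero] at hg ⊢
  rintro (_ | m) hm
  · omega
  · rw [coeff_raiseOp_succ, hg m (by omega), hg (m + 1) (by omega)]
    ring

theorem coeff_scaledDiff (p : ℝ[X]) (r : ℕ) :
    (scaledDiff b p).coeff r = (b ^ (r + 1) - 1) * p.coeff (r + 1) := by
  rw [scaledDiff, coeff_divX, coeff_sub, comp_C_mul_X_coeff]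
  ring

theorem mul_eval_scaledDiff (p : ℝ[X]) (x : ℝ) :
    x * (scaledDiff b p).eval x = p.eval (b * x) - p.eval x := by
  have h := congrArg (eval x) (divX_mul_X_add (p.comp (C b * X) - p))
  have h0 : (p.comp (C b * X) - p).coeff 0 = 0 := by
    rw [coeff_sub, comp_C_mul_X_coeff]; simp
  rw [h0, C_0, add_zero, eval_mul, eval_X, eval_sub, eval_comp, eval_mul, eval_C, eval_X] at h
  rw [scaledDiff, mul_comm, h]

theorem eval_jacobiOp (p : ℝ[X]) (x : ℝ) : (jacobiOp A B b p).eval x =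
    A / b * (B * x - 1) * (scaledDiff b p).eval x -
      b⁻¹ * (x - 1) * (scaledDiff b p).eval (b⁻¹ * x) := by
  simp [jacobiOp]

theorem coeff_jacobiOp (p : ℝ[X]) (r : ℕ) : (jacobiOp A B b p).coeff r =
    (b ^ r - 1) * (A * B / b - b⁻¹ ^ r) * p.coeff r +
      (b ^ (r + 1) - 1) * (b⁻¹ ^ (r + 1) - A / b) * p.coeff (r + 1) := by
  rcases r with _ | r
  · simp only [jacobiOp, sub_mul, mul_sub, one_mul, mul_one, coeff_sub, mul_assoc, coeff_C_mul,
      coeff_X_mul_zero, comp_C_mul_X_coeff, coeff_scaledDiff]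
    simp
    ring
  · simp only [jacobiOp, sub_mul, mul_sub, one_mul, mul_one, coeff_sub, mul_assoc, coeff_C_mul,
      coeff_X_mul, comp_C_mul_X_coeff, coeff_scaledDiff]
    ring

/-- A polynomial whose coefficients satisfy the little `q`-Jacobi recurrence is an eigenfunction of
the difference operator. -/
theorem jacobiOp_eq_of_recurrence (hb : b ≠ 0) (p : ℝ[X]) (n : ℕ)
    (h : ∀ r, p.coeff (r + 1) * ((1 - b ^ (r + 1)) * (1 - A * b ^ r)) =
      p.coeff r * (b * (1 - (b ^ n)⁻¹ * b ^ r) * (1 - A * B * b ^ n / b * b ^ r))) :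
    jacobiOp A B b p = C ((b ^ n - 1) * (A * B / b - (b ^ n)⁻¹)) * p := by
  ext r
  rw [coeff_jacobiOp, coeff_C_mul]
  have h' : (b ^ (r + 1) - 1) * (b⁻¹ ^ (r + 1) - A / b) * p.coeff (r + 1) =
      -(b⁻¹ ^ (r + 1)) * (p.coeff (r + 1) * ((1 - b ^ (r + 1)) * (1 - A * b ^ r))) := by
    rw [inv_pow, pow_succ]
    field_simp
    ring
  rw [h', h, inv_pow, inv_pow, pow_succ]
  field_simp
  ring

end coefficients

section forms

variable {A B b : ℝ} {ρ : ℕ → ℝ}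

theorem exists_abs_eval_pow_le (hb0 : 0 ≤ b) (hb1 : b ≤ 1) (f : ℝ[X]) :
    ∃ K, ∀ m : ℕ, |f.eval (b ^ m)| ≤ K := by
  obtain ⟨K, hK⟩ := (isCompact_Icc (a := (0 : ℝ)) (b := 1)).exists_bound_of_continuousOn
    f.continuous.continuousOn
  exact ⟨K, fun m => hK _ ⟨by positivity, pow_le_one₀ hb0 hb1⟩⟩

theorem summable_eval_pow_mul (hb0 : 0 ≤ b) (hb1 : b ≤ 1) (f : ℝ[X]) {v : ℕ → ℝ}
    (hv : Summable v) : Summable fun m => f.eval (b ^ m) * v m := by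
  obtain ⟨K, hK⟩ := exists_abs_eval_pow_le hb0 hb1 f
  refine Summable.of_norm_bounded (hv.norm.mul_left K) fun m => ?_
  rw [norm_mul]
  exact mul_le_mul_of_nonneg_right (hK m) (norm_nonneg _)

namespace IsLatticeWeight

variable (hW : IsLatticeWeight A B b ρ)
include hW

theorem summable_eval_mul (f : ℝ[X]) {v : ℕ → ℝ} (hv : Summable v) :
    Summable fun m => f.eval (b ^ m) * v m :=
  summable_eval_pow_mul hW.b_pos.le hW.b_lt_one.le f hv

theorem summable_lattice (f : ℝ[X]) : Summable fun m => f.eval (b ^ m) * ρ m :=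
  hW.summable_eval_mul f hW.summable

theorem jacobiWeight_pos (m : ℕ) : 0 < jacobiWeight b ρ m :=
  mul_pos (mul_pos (hW.pos _) (hW.pos _))
    (sub_pos.2 (pow_lt_one₀ hW.b_pos.le hW.b_lt_one (by omega)))

theorem summable_raise (g : ℝ[X]) :
    Summable fun m => (1 - b ^ (m + 1)) * ρ (m + 1) * g.eval (b ^ m) := by
  have h1 : Summable fun m => ρ (m + 1) := (summable_nat_add_iff 1).2 hW.summable
  refine (hW.summable_eval_mul ((1 - C b * X) * g) h1).congr fun m => ?_
  simp [pow_succ']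
  ring

theorem summable_jacobiWeight : Summable (jacobiWeight b ρ) := by
  refine (summable_mul_of_summable hW.summable (hW.summable_raise 1)).congr fun m => ?_
  simp [jacobiWeight]
  ring

/-- Consecutive weights share the factor `ρ (m + 1)`, so the two-step recurrence of `ρ` becomes the
one-step Pearson equation of little q-Jacobi type. -/
theorem jacobiWeight_succ (m : ℕ) : (1 - b ^ (m + 1)) * jacobiWeight b ρ (m + 1) =
    A * (1 - B * b ^ m) * jacobiWeight b ρ m := by
  have := hW.recurrence m
  rw [jacobiWeight, jacobiWeight]
  linear_combination (1 - b ^ (m + 1)) * ρ (m + 1) * this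

/-- The bilinear form of the little `q`-Jacobi polynomials. -/
def jacobiForm : ℝ[X] →ₗ[ℝ] ℝ[X] →ₗ[ℝ] ℝ :=
  have hs (f g : ℝ[X]) : Summable fun m => f.eval (b ^ m) * g.eval (b ^ m) * jacobiWeight b ρ m :=
    (hW.summable_eval_mul (f * g) hW.summable_jacobiWeight).congr fun m => by rw [eval_mul]
  LinearMap.mk₂ ℝ (fun f g => ∑' m, f.eval (b ^ m) * g.eval (b ^ m) * jacobiWeight b ρ m)
    (fun f f' g => by
      rw [← (hs f g).tsum_add (hs f' g)]
      exact tsum_congr fun m => by rw [eval_add]; ring)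
    (fun c f g => by
      rw [smul_eq_mul, ← tsum_mul_left]
      exact tsum_congr fun m => by rw [eval_smul, smul_eq_mul]; ring)
    (fun f g g' => by
      rw [← (hs f g).tsum_add (hs f g')]
      exact tsum_congr fun m => by rw [eval_add]; ring)
    (fun c f g => by
      rw [smul_eq_mul, ← tsum_mul_left]
      exact tsum_congr fun m => by rw [eval_smul, smul_eq_mul]; ring)

theorem jacobiForm_apply (f g : ℝ[X]) : hW.jacobiForm f g =
    ∑' m, f.eval (b ^ m) * g.eval (b ^ m) * jacobiWeight b ρ m := rfl

/-- The skew form on the lattice. -/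
def skewForm : ℝ[X] →ₗ[ℝ] ℝ[X] →ₗ[ℝ] ℝ :=
  have hs := hW.summable_lattice
  LinearMap.mk₂ ℝ (fun f g =>
      evenOddSum (fun m => g.eval (b ^ m) * ρ m) (fun m => f.eval (b ^ m) * ρ m) -
      evenOddSum (fun m => f.eval (b ^ m) * ρ m) (fun m => g.eval (b ^ m) * ρ m))
    (fun f f' g => by
      simp only [eval_add, add_mul]
      rw [evenOddSum_add_left (hs f) (hs f') (hs g), evenOddSum_add_right (hs g) (hs f) (hs f')]
      ring)
    (fun c f g => by
      simp only [eval_smul, smul_eq_mul, mul_assoc]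
      rw [evenOddSum_smul_left, evenOddSum_smul_right]
      ring)
    (fun f g g' => by
      simp only [eval_add, add_mul]
      rw [evenOddSum_add_left (hs g) (hs g') (hs f), evenOddSum_add_right (hs f) (hs g) (hs g')]
      ring)
    (fun c f g => by
      simp only [eval_smul, smul_eq_mul, mul_assoc]
      rw [evenOddSum_smul_left, evenOddSum_smul_right]
      ring)

theorem skewForm_apply (f g : ℝ[X]) : hW.skewForm f g =
    evenOddSum (fun m => g.eval (b ^ m) * ρ m) (fun m => f.eval (b ^ m) * ρ m) -
      evenOddSum (fun m => f.eval (b ^ m) * ρ m) (fun m => g.eval (b ^ m) * ρ m) := rfl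

theorem skewForm_swap (f g : ℝ[X]) : hW.skewForm g f = -hW.skewForm f g := by
  rw [skewForm_apply, skewForm_apply, neg_sub]

theorem skewForm_self (f : ℝ[X]) : hW.skewForm f f = 0 := by
  rw [skewForm_apply, sub_self]

theorem jacobiForm_comm (f g : ℝ[X]) : hW.jacobiForm f g = hW.jacobiForm g f := by
  simp only [jacobiForm_apply, mul_comm (eval _ f)]

/-- The weight is positive at the infinitely many points `b ^ m`, so `f` would have infinitely many
roots. -/
theorem jacobiForm_self_eq_zero {f : ℝ[X]} (h : hW.jacobiForm f f = 0) : f = 0 := by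
  have hs : Summable fun m => f.eval (b ^ m) * f.eval (b ^ m) * jacobiWeight b ρ m :=
    (hW.summable_eval_mul (f * f) hW.summable_jacobiWeight).congr fun m => by rw [eval_mul]
  have hnn : ∀ m, 0 ≤ f.eval (b ^ m) * f.eval (b ^ m) * jacobiWeight b ρ m := fun m =>
    mul_nonneg (mul_self_nonneg _) (hW.jacobiWeight_pos m).le
  rw [jacobiForm_apply] at h
  have h0 := (hasSum_zero_iff_of_nonneg hnn).1 (h ▸ hs.hasSum)
  refine eq_zero_of_infinite_isRoot f ?_
  refine (Set.infinite_range_of_injective (pow_right_injective₀ hW.b_pos hW.b_lt_one.ne)).mono ?_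
  rintro _ ⟨m, rfl⟩
  have := congrFun h0 m
  simpa [(hW.jacobiWeight_pos m).ne'] using this

/-- With `G m = (1 - b^(m+1)) ρ(m+1) g(b^m)`, the recurrence of `ρ` says that `ρ` times `raiseOp A B
b g` at index `m + 1` is `G m - G (m+2)`. The telescoping lemma then leaves `∑ f(b^m) ρ(m) G(m)`,
which is the Jacobi form. -/
theorem skewForm_raiseOp (f g : ℝ[X]) :
    hW.skewForm f (raiseOp A B b g) = -hW.jacobiForm f g := by
  have hb := hW.b_pos.ne'
  have hrec := hW.recurrence
  have hev : ∀ x : ℝ, (raiseOp A B b g).eval x =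
      (1 - x) * g.eval (b⁻¹ * x) - A * (1 - B * x) * g.eval (b * x) := fun x => by
    simp [raiseOp]
  rw [skewForm_apply, ← neg_sub, evenOddSum_sub_of_telescoping (hW.summable_lattice _)
    (hW.summable_lattice _) (hW.summable_raise g), jacobiForm_apply]
  · congr 1
    refine tsum_congr fun m => ?_
    rw [jacobiWeight]; ring
  -- At the endpoint `x = 1` the factor `1 - x` removes the value of `g` at `b⁻¹`, outside the
  -- lattice.
  · rw [hev]
    have := hrec 0
    simp only [pow_zero, mul_one, sub_self, zero_mul, zero_add, pow_one] at this ⊢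
    norm_num
    linear_combination -g.eval b * this
  · intro m
    rw [hev, show b⁻¹ * b ^ (m + 1) = b ^ m by rw [pow_succ']; field_simp,
      show b * b ^ (m + 1) = b ^ (m + 2) by ring]
    have := hrec (m + 1)
    rw [show m + 1 + 2 = m + 2 + 1 by ring] at this
    linear_combination g.eval (b ^ (m + 2)) * this

/-- Both sides are values of the skew form on `raiseOp A B b f` and `raiseOp A B b g`, up to sign.
-/
theorem jacobiForm_raiseOp_left (f g : ℝ[X]) :
    hW.jacobiForm (raiseOp A B b f) g = -hW.jacobiForm f (raiseOp A B b g) := by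
  rw [← neg_inj, ← hW.skewForm_raiseOp, hW.skewForm_swap, hW.skewForm_raiseOp,
    hW.jacobiForm_comm f]

theorem jacobiForm_jacobiOp_left (f g : ℝ[X]) :
    hW.jacobiForm (jacobiOp A B b f) g = hW.jacobiForm f (jacobiOp A B b g) := by
  have hb := hW.b_pos.ne'
  have hs (f g : ℝ[X]) : Summable fun m => f.eval (b ^ m) * g.eval (b ^ m) * jacobiWeight b ρ m :=
    (hW.summable_eval_mul (f * g) hW.summable_jacobiWeight).congr fun m => by rw [eval_mul]
  rw [← sub_eq_zero, jacobiForm_apply, jacobiForm_apply, ← (hs _ _).tsum_sub (hs _ _)]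
  -- `V` is the weighted q-Wronskian of `f` and `g`; the Lagrange identity makes each term of the
  -- difference an increment of `V`.
  let V : ℕ → ℝ := fun m => A / b * (1 - B * b ^ m) * jacobiWeight b ρ m *
    (f.eval (b ^ m) * (scaledDiff b g).eval (b ^ m) - g.eval (b ^ m) * (scaledDiff b f).eval (b ^ m))
  have hV : Summable V := by
    refine (hW.summable_eval_mul (C (A / b) * (1 - C B * X) *
      (f * scaledDiff b g - g * scaledDiff b f)) hW.summable_jacobiWeight).congr fun m => ?_
    simp [V]
    ring
  rw [((hs _ _).sub (hs _ _)).tsum_eq_zero_add]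
  have hV' : Summable fun m => V (m + 1) := (summable_nat_add_iff 1).2 hV
  have hterm : ∀ m, (jacobiOp A B b f).eval (b ^ (m + 1)) * g.eval (b ^ (m + 1)) *
      jacobiWeight b ρ (m + 1) - f.eval (b ^ (m + 1)) * (jacobiOp A B b g).eval (b ^ (m + 1)) *
      jacobiWeight b ρ (m + 1) = V (m + 1) - V m := by
    intro m
    have h1 := mul_eval_scaledDiff (b := b) f (b ^ m)
    have h2 := mul_eval_scaledDiff (b := b) g (b ^ m)
    have h3 := hW.jacobiWeight_succ m
    rw [eval_jacobiOp, eval_jacobiOp, show b⁻¹ * b ^ (m + 1) = b ^ m by rw [pow_succ']; field_simp]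
    rw [← pow_succ'] at h1 h2
    simp only [V]
    have h4 : b⁻¹ * (1 - b ^ (m + 1)) * jacobiWeight b ρ (m + 1) *
        ((scaledDiff b f).eval (b ^ m) * g.eval (b ^ (m + 1)) -
          f.eval (b ^ (m + 1)) * (scaledDiff b g).eval (b ^ m)) =
        -(A / b * (1 - B * b ^ m) * jacobiWeight b ρ m * (f.eval (b ^ m) *
          (scaledDiff b g).eval (b ^ m) - g.eval (b ^ m) * (scaledDiff b f).eval (b ^ m))) := by
      rw [show f.eval (b ^ (m + 1)) = f.eval (b ^ m) + b ^ m * (scaledDiff b f).eval (b ^ m) by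
        linarith, show g.eval (b ^ (m + 1)) =
          g.eval (b ^ m) + b ^ m * (scaledDiff b g).eval (b ^ m) by linarith]
      linear_combination b⁻¹ * ((scaledDiff b f).eval (b ^ m) * g.eval (b ^ m) -
          f.eval (b ^ m) * (scaledDiff b g).eval (b ^ m)) * h3
    linear_combination h4
  simp_rw [hterm]
  -- The increments sum to `-V 0`. The term at `m = 0` equals `V 0`, since the factor `x - 1` of the
  -- operator vanishes at `x = 1`.
  rw [hV'.tsum_sub hV, hV.tsum_eq_zero_add, eval_jacobiOp, eval_jacobiOp]
  simp only [V]
  simp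
  ring

end IsLatticeWeight

end forms

/-! ### Coefficients of the little q-Jacobi polynomials -/

/-- The monic little `q`-Jacobi polynomial in base `b` with parameters `A = b^{α+1}`,
`B = b^{β+1}`. -/
def littleJacobi (A B b : ℝ) (n : ℕ) : ℝ[X] :=
  C ((-1) ^ n * b ^ (n * (n - 1) / 2) * qPoch A b n / qPoch (A * B * b ^ n / b) b n) *
    ∑ r ∈ Finset.range (n + 1),
      C (qPoch (b ^ n)⁻¹ b r * qPoch (A * B * b ^ n / b) b r / (qPoch b b r * qPoch A b r)) *
        (C b * X) ^ r

/-- Each factor obeys `(1 - b^(-k)) b^k = -(1 - b^k)`. This evaluation makes the prefactor of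
`littleJacobi` normalize the leading coefficient to one. -/
theorem qPoch_inv_pow {b : ℝ} (hb : b ≠ 0) (n : ℕ) :
    qPoch (b ^ n)⁻¹ b n * (b ^ (n * (n - 1) / 2) * b ^ n) = (-1) ^ n * qPoch b b n := by
  induction n with
  | zero => simp [qPoch]
  | succ n ih =>
    have h1 : (b ^ (n + 1))⁻¹ * b = (b ^ n)⁻¹ := by rw [pow_succ]; field_simp
    rw [qPoch_succ', h1, Nat.triangle_succ, qPoch_succ, pow_add, pow_succ (-1 : ℝ)]
    have h2 : (1 - (b ^ (n + 1))⁻¹) * b ^ (n + 1) = -(1 - b * b ^ n) := by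
      rw [pow_succ]; field_simp; ring
    linear_combination (-(1 - b * b ^ n)) * ih +
      qPoch (b ^ n)⁻¹ b n * (b ^ (n * (n - 1) / 2) * b ^ n) * h2

section

variable {A B b : ℝ} (hb0 : 0 < b) (hb1 : b < 1) (hA0 : 0 < A) (hA1 : A < 1)
  (hB1 : B < 1)

theorem coeff_littleJacobi (A B b : ℝ) (n r : ℕ) : (littleJacobi A B b n).coeff r =
    (-1) ^ n * b ^ (n * (n - 1) / 2) * qPoch A b n / qPoch (A * B * b ^ n / b) b n *
      if r < n + 1 then qPoch (b ^ n)⁻¹ b r * qPoch (A * B * b ^ n / b) b r /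
        (qPoch b b r * qPoch A b r) * b ^ r else 0 := by
  rw [littleJacobi, coeff_C_mul, finsetSum_coeff]
  congr 1
  simp_rw [mul_pow, ← C_pow, coeff_C_mul, coeff_X_pow, mul_ite, mul_one, mul_zero,
    Finset.sum_ite_eq, Finset.mem_range]

include hb0 hb1 hA0 hA1 hB1 in
theorem mul_mul_pow_lt_one {k : ℕ} : A * B * b ^ k < 1 :=
  mul_pow_lt_one (by nlinarith) hb0.le hb1 k

include hb0 hb1 hA0 hA1 hB1 in
-- For `n = 0` the parameter is `A * B / b`, which need not be less than one; only the empty product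
-- is then safe.
theorem qPoch_mul_mul_pow_div_pos (n r : ℕ) (h : n ≠ 0 ∨ r = 0) :
    0 < qPoch (A * B * b ^ n / b) b r := by
  rcases n with _ | n
  · obtain rfl : r = 0 := by simpa using h
    simp [qPoch]
  · refine qPoch_pos ?_ hb0.le hb1 r
    rw [pow_succ, ← mul_assoc, mul_div_cancel_right₀ _ hb0.ne']
    exact mul_mul_pow_lt_one hb0 hb1 hA0 hA1 hB1

include hb0 hb1 hA0 hA1 hB1 in
theorem monic_littleJacobi_coeff (n : ℕ) : (littleJacobi A B b n).coeff n = 1 := by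
  have h1 := (qPoch_mul_mul_pow_div_pos hb0 hb1 hA0 hA1 hB1 n n (by tauto)).ne'
  have h2 := (qPoch_pos hA1 hb0.le hb1 n).ne'
  have h3 := (qPoch_pos hb1 hb0.le hb1 n).ne'
  have h4 := qPoch_inv_pow hb0.ne' n
  have h5 : ((-1 : ℝ) ^ n) * (-1) ^ n = 1 := by rw [← mul_pow]; simp
  rw [coeff_littleJacobi, if_pos (by omega)]
  generalize (b ^ n)⁻¹ = s at *
  field_simp
  linear_combination (-1) ^ n * h4 + qPoch b b n * h5

include hb0 hb1 hA0 hA1 hB1 in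
theorem degree_littleJacobi (n : ℕ) : (littleJacobi A B b n).degree = n := by
  refine le_antisymm ?_ (le_degree_of_ne_zero ?_)
  · rw [degree_le_iff_coeff_zero]
    intro m hm
    have : n < m := by exact_mod_cast hm
    rw [coeff_littleJacobi, if_neg (by omega), mul_zero]
  · rw [monic_littleJacobi_coeff hb0 hb1 hA0 hA1 hB1]
    exact one_ne_zero

include hb0 hb1 hA0 hA1 hB1 in
theorem monic_littleJacobi (n : ℕ) : (littleJacobi A B b n).Monic := by
  rw [Monic, leadingCoeff,
    natDegree_eq_of_degree_eq_some (degree_littleJacobi hb0 hb1 hA0 hA1 hB1 n)]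
  exact monic_littleJacobi_coeff hb0 hb1 hA0 hA1 hB1 n

include hb0 hb1 hA1 in
theorem littleJacobi_recurrence (n r : ℕ) :
    (littleJacobi A B b n).coeff (r + 1) * ((1 - b ^ (r + 1)) * (1 - A * b ^ r)) =
      (littleJacobi A B b n).coeff r *
        (b * (1 - (b ^ n)⁻¹ * b ^ r) * (1 - A * B * b ^ n / b * b ^ r)) := by
  rw [coeff_littleJacobi, coeff_littleJacobi]
  rcases lt_trichotomy r n with h | rfl | h
  · rw [if_pos (by omega), if_pos (by omega), qPoch_succ, qPoch_succ, qPoch_succ, qPoch_succ]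
    have h1 := (qPoch_pos hb1 hb0.le hb1 r).ne'
    have h2 := (qPoch_pos hA1 hb0.le hb1 r).ne'
    have h3 : 1 - A * b ^ r ≠ 0 := (sub_pos.2 (mul_pow_lt_one hA1 hb0.le hb1 r)).ne'
    have h4 : 1 - b * b ^ r ≠ 0 := (sub_pos.2 (mul_pow_lt_one hb1 hb0.le hb1 r)).ne'
    rw [pow_succ' b r]
    generalize A * B * b ^ n / b = t
    generalize (b ^ n)⁻¹ = s
    generalize (-1) ^ n * b ^ (n * (n - 1) / 2) * qPoch A b n / qPoch t b n = K
    rw [mul_assoc K, mul_assoc K]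
    congr 1
    rw [show qPoch b b r * (1 - b * b ^ r) * (qPoch A b r * (1 - A * b ^ r)) =
      (qPoch b b r * qPoch A b r) * ((1 - b * b ^ r) * (1 - A * b ^ r)) by ring]
    have h5 : (1 - b * b ^ r) * (1 - A * b ^ r) ≠ 0 := mul_ne_zero h4 h3
    have h6 : qPoch b b r * qPoch A b r ≠ 0 := mul_ne_zero h1 h2
    generalize (1 - b * b ^ r) * (1 - A * b ^ r) = D at *
    generalize qPoch b b r * qPoch A b r = D' at *
    field_simp
  -- At `r = n` the factor `1 - b^(-n) b^n` vanishes, in accordance with the termination of the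
  -- series.
  · rw [if_neg (by omega), inv_mul_cancel₀ (pow_ne_zero _ hb0.ne')]
    simp
  · rw [if_neg (by omega), if_neg (by omega)]
    simp

theorem coeff_zero_littleJacobi (A B b : ℝ) (n : ℕ) : (littleJacobi A B b n).coeff 0 =
    (-1) ^ n * b ^ (n * (n - 1) / 2) * qPoch A b n / qPoch (A * B * b ^ n / b) b n := by
  rw [coeff_littleJacobi, if_pos (by omega)]
  simp [qPoch]

end

/-! ### Orthogonality and the action of the raising operator -/

/-- A family with one monic polynomial in each degree spans the polynomials of bounded degree. -/
theorem induction_on_monic_family {p : ℕ → ℝ[X]} (hd : ∀ n, (p n).degree = n)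
    {n : ℕ} {P : ℝ[X] → Prop} (h0 : P 0) (hadd : ∀ f g, P f → P g → P (f + g))
    (hp : ∀ k < n, ∀ c, P (C c * p k)) {f : ℝ[X]} (hf : f.degree < n) : P f := by
  induction n generalizing f with
  | zero =>
    rw [Nat.cast_zero, Nat.WithBot.lt_zero_iff, degree_eq_bot] at hf
    rwa [hf]
  | succ n ih =>
    have hc : (p n).coeff n ≠ 0 := fun h => by
      have := (degree_lt_iff_coeff_zero (p n) n).2 fun m hm => by
        rcases hm.eq_or_lt with rfl | hm
        · exact h
        · exact coeff_eq_zero_of_degree_lt (by rw [hd]; exact_mod_cast hm)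
      rw [hd] at this
      exact lt_irrefl _ this
    have hlow : (f - C (f.coeff n / (p n).coeff n) * p n).degree < n := by
      rw [degree_lt_iff_coeff_zero]
      intro m hm
      rcases hm.eq_or_lt with rfl | hm
      · rw [coeff_sub, coeff_C_mul, div_mul_cancel₀ _ hc, sub_self]
      · rw [coeff_sub, coeff_C_mul, (degree_lt_iff_coeff_zero f _).1 hf m hm,
          coeff_eq_zero_of_degree_lt (p := p n) (n := m) (by rw [hd]; exact_mod_cast hm), mul_zero,
          sub_zero]
    have := hadd _ _ (ih (fun k hk => hp k (by omega)) hlow)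
      (hp n (by omega) (f.coeff n / (p n).coeff n))
    rwa [sub_add_cancel] at this

theorem apply_eq_zero_of_monic_family {p : ℕ → ℝ[X]} (hd : ∀ n, (p n).degree = n)
    {n : ℕ} (T : ℝ[X] →ₗ[ℝ] ℝ) (hp : ∀ k < n, T (p k) = 0) {f : ℝ[X]} (hf : f.degree < n) :
    T f = 0 :=
  induction_on_monic_family hd (P := fun f => T f = 0) (map_zero T)
    (fun f g hf hg => by rw [map_add, hf, hg, add_zero])
    (fun k hk c => by rw [← smul_eq_C_mul, map_smul, hp k hk, smul_zero]) hf

/-- The leading coefficient of `raiseOp A B b p` for monic `p` of degree `n`. -/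
def raiseCoeff (A B b : ℝ) (n : ℕ) : ℝ := -((b ^ n)⁻¹ * (1 - A * B * b ^ (2 * n)))

namespace IsLatticeWeight

variable {A B b : ℝ} {ρ : ℕ → ℝ} (hW : IsLatticeWeight A B b ρ)
include hW

theorem degree_littleJacobi (n : ℕ) : (littleJacobi A B b n).degree = n :=
  _root_.degree_littleJacobi hW.b_pos hW.b_lt_one hW.A_pos hW.A_lt_one hW.B_lt_one n

theorem monic_littleJacobi (n : ℕ) : (littleJacobi A B b n).Monic :=
  _root_.monic_littleJacobi hW.b_pos hW.b_lt_one hW.A_pos hW.A_lt_one hW.B_lt_one n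

theorem coeff_littleJacobi_self (n : ℕ) : (littleJacobi A B b n).coeff n = 1 :=
  monic_littleJacobi_coeff hW.b_pos hW.b_lt_one hW.A_pos hW.A_lt_one hW.B_lt_one n

theorem mul_mul_pow_lt_one (k : ℕ) : A * B * b ^ k < 1 :=
  _root_.mul_mul_pow_lt_one hW.b_pos hW.b_lt_one hW.A_pos hW.A_lt_one hW.B_lt_one

/-- Eigenfunctions of a symmetric operator with distinct eigenvalues are orthogonal. The difference
of eigenvalues contains the factors `b^m - b^n` and `1 - A B b^(m+n-1)`; the second is positive
because `m ≠ n` forces `m + n ≥ 1`. -/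
theorem jacobiForm_littleJacobi_of_ne {m n : ℕ} (hmn : m ≠ n) :
    hW.jacobiForm (littleJacobi A B b m) (littleJacobi A B b n) = 0 := by
  have hb := hW.b_pos
  have heig : ∀ n, jacobiOp A B b (littleJacobi A B b n) =
      ((b ^ n - 1) * (A * B / b - (b ^ n)⁻¹)) • littleJacobi A B b n := fun n => by
    rw [smul_eq_C_mul]
    exact jacobiOp_eq_of_recurrence hb.ne' _ n
      (littleJacobi_recurrence hb hW.b_lt_one hW.A_lt_one n)
  have h := hW.jacobiForm_jacobiOp_left (littleJacobi A B b m) (littleJacobi A B b n)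
  rw [heig, heig, map_smul, map_smul, LinearMap.smul_apply, smul_eq_mul, smul_eq_mul,
    ← sub_eq_zero, ← sub_mul] at h
  refine (mul_eq_zero.1 h).resolve_left ?_
  have hne : b ^ m ≠ b ^ n := (pow_right_injective₀ hb hW.b_lt_one.ne).ne hmn
  have hlt : A * B * b ^ (m + n - 1) < 1 := hW.mul_mul_pow_lt_one _
  have hbp : b ^ m * b ^ n = b ^ (m + n - 1) * b := by
    rw [← pow_add, ← pow_succ]
    congr 1
    omega
  have hfac : (b ^ m - 1) * (A * B / b - (b ^ m)⁻¹) - (b ^ n - 1) * (A * B / b - (b ^ n)⁻¹) =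
      -(b ^ m - b ^ n) * (1 - A * B * b ^ (m + n - 1)) / (b ^ m * b ^ n) := by
    rw [show A * B * b ^ (m + n - 1) = A * B / b * (b ^ m * b ^ n) by rw [hbp]; field_simp]
    field_simp
    ring
  rw [hfac]
  refine div_ne_zero (mul_ne_zero (neg_ne_zero.2 (sub_ne_zero.2 hne)) ?_) (by positivity)
  linarith

theorem jacobiForm_eq_zero_of_degree_lt {f : ℝ[X]} {n : ℕ} (hf : f.degree < n) :
    hW.jacobiForm f (littleJacobi A B b n) = 0 :=
  apply_eq_zero_of_monic_family hW.degree_littleJacobi (hW.jacobiForm.flip (littleJacobi A B b n))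
    (fun _ hk => hW.jacobiForm_littleJacobi_of_ne hk.ne) hf

/-- The squared norms of the little `q`-Jacobi polynomials. -/
def jacobiNorm (n : ℕ) : ℝ := hW.jacobiForm (littleJacobi A B b n) (littleJacobi A B b n)

theorem jacobiNorm_ne_zero (n : ℕ) : hW.jacobiNorm n ≠ 0 := fun h =>
  (hW.monic_littleJacobi n).ne_zero (hW.jacobiForm_self_eq_zero h)

theorem raiseCoeff_ne_zero (n : ℕ) : raiseCoeff A B b n ≠ 0 :=
  neg_ne_zero.2 (mul_ne_zero (inv_ne_zero (pow_ne_zero _ hW.b_pos.ne'))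
    (sub_pos.2 (hW.mul_mul_pow_lt_one _)).ne')

theorem degree_raiseOp_sub_lt (n : ℕ) : (raiseOp A B b (littleJacobi A B b n) -
    C (raiseCoeff A B b n) * littleJacobi A B b (n + 1)).degree < (n + 1 : ℕ) := by
  have h1 := hW.degree_littleJacobi
  have hb := hW.b_pos.ne'
  rw [degree_lt_iff_coeff_zero]
  rintro (_ | m) hm
  · omega
  rw [coeff_sub, coeff_C_mul]
  rcases hm.eq_or_lt with h | h
  · obtain rfl : n = m := by omega
    rw [coeff_raiseOp_succ, hW.coeff_littleJacobi_self, hW.coeff_littleJacobi_self,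
      coeff_eq_zero_of_degree_lt (by rw [h1]; exact_mod_cast Nat.lt_succ_self n), raiseCoeff,
      inv_pow, inv_pow, pow_mul', sq]
    field_simp
    ring
  · have h2 : (raiseOp A B b (littleJacobi A B b n)).degree < (n + 1 + 1 : ℕ) :=
      degree_raiseOp_lt (by rw [h1]; exact_mod_cast Nat.lt_succ_self n)
    rw [(degree_lt_iff_coeff_zero _ _).1 h2 (m + 1) (by omega),
      coeff_eq_zero_of_degree_lt (by rw [h1]; exact_mod_cast h), mul_zero, sub_zero]

theorem jacobiForm_raiseOp_succ (n : ℕ) :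
    hW.jacobiForm (raiseOp A B b (littleJacobi A B b n)) (littleJacobi A B b (n + 1)) =
      raiseCoeff A B b n * hW.jacobiNorm (n + 1) := by
  have h := hW.jacobiForm_eq_zero_of_degree_lt (hW.degree_raiseOp_sub_lt n)
  rwa [← smul_eq_C_mul, map_sub, map_smul, LinearMap.sub_apply, LinearMap.smul_apply,
    smul_eq_mul, sub_eq_zero] at h

theorem jacobiForm_raiseOp_self (f : ℝ[X]) : hW.jacobiForm (raiseOp A B b f) f = 0 := by
  have := hW.jacobiForm_raiseOp_left f f
  rw [hW.jacobiForm_comm f] at this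
  linarith

theorem eq_zero_of_jacobiForm_littleJacobi {f : ℝ[X]} {n : ℕ} (hf : f.degree < n)
    (h : ∀ k < n, hW.jacobiForm f (littleJacobi A B b k) = 0) : f = 0 :=
  hW.jacobiForm_self_eq_zero
    (apply_eq_zero_of_monic_family hW.degree_littleJacobi (hW.jacobiForm f) h hf)

theorem raiseOp_littleJacobi_zero : raiseOp A B b (littleJacobi A B b 0) =
    C (raiseCoeff A B b 0) * littleJacobi A B b 1 := by
  rw [← sub_eq_zero]
  refine hW.eq_zero_of_jacobiForm_littleJacobi (hW.degree_raiseOp_sub_lt 0) fun k hk => ?_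
  obtain rfl : k = 0 := by omega
  rw [← smul_eq_C_mul, map_sub, map_smul, LinearMap.sub_apply, LinearMap.smul_apply,
    hW.jacobiForm_raiseOp_self, hW.jacobiForm_littleJacobi_of_ne (by omega), smul_zero, sub_zero]

/-- Skew-adjointness moves the operator to the other argument, where the degree bound kills every
component below `n`; it also kills the component along `p (n+1)` itself. The component along `p n`
is read off from the leading coefficient of `raiseOp A B b (p n)`. -/
theorem raiseOp_littleJacobi_succ (n : ℕ) : raiseOp A B b (littleJacobi A B b (n + 1)) =
    C (raiseCoeff A B b (n + 1)) * littleJacobi A B b (n + 2) -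
      C (raiseCoeff A B b n * hW.jacobiNorm (n + 1) / hW.jacobiNorm n) * littleJacobi A B b n := by
  have hd := hW.degree_littleJacobi
  rw [eq_sub_iff_add_eq, ← sub_eq_zero]
  refine hW.eq_zero_of_jacobiForm_littleJacobi (n := n + 2) ?_ fun k hk => ?_
  · rw [add_sub_right_comm]
    refine (degree_add_le _ _).trans_lt (max_lt (hW.degree_raiseOp_sub_lt (n + 1)) ?_)
    rw [← smul_eq_C_mul]
    refine (degree_smul_le _ _).trans_lt ?_
    rw [hd]
    exact_mod_cast (by omega : n < n + 2)
  · rw [← smul_eq_C_mul, ← smul_eq_C_mul, map_sub, map_add, map_smul, map_smul,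
      LinearMap.sub_apply, LinearMap.add_apply, LinearMap.smul_apply, LinearMap.smul_apply,
      hW.jacobiForm_littleJacobi_of_ne (by omega : n + 2 ≠ k), smul_zero, sub_zero]
    rcases lt_trichotomy k n with h | rfl | h
    · rw [hW.jacobiForm_littleJacobi_of_ne h.ne', hW.jacobiForm_raiseOp_left, hW.jacobiForm_comm,
        hW.jacobiForm_eq_zero_of_degree_lt (n := n + 1), smul_zero, neg_zero, add_zero]
      refine (degree_raiseOp_lt (n := k + 1) ?_).trans_le (by exact_mod_cast (by omega))
      rw [hd]
      exact_mod_cast Nat.lt_succ_self k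
    · rw [hW.jacobiForm_raiseOp_left, hW.jacobiForm_comm, hW.jacobiForm_raiseOp_succ, smul_eq_mul]
      change _ + _ * hW.jacobiNorm k = 0
      rw [div_mul_cancel₀ _ (hW.jacobiNorm_ne_zero k), neg_add_cancel]
    · obtain rfl : k = n + 1 := by omega
      rw [hW.jacobiForm_raiseOp_self, hW.jacobiForm_littleJacobi_of_ne (by omega), smul_zero,
        add_zero]

end IsLatticeWeight

/-! ### The skew orthogonal family and its uniqueness -/

/-- The coefficient of `p_n` (up to sign) in `raiseOp A B b p_{n+1}` divided by its leading
coefficient. It is found by comparing constant terms. -/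
def raiseRatio (A B b : ℝ) (n : ℕ) : ℝ :=
  (raiseCoeff A B b (n + 1) * (littleJacobi A B b (n + 2)).coeff 0 -
    (1 - A) * (littleJacobi A B b (n + 1)).coeff 0) /
      (raiseCoeff A B b (n + 1) * (littleJacobi A B b n).coeff 0)

/-- The skew orthogonal polynomials. -/
def skewJacobi (A B b : ℝ) : ℕ → ℝ[X]
  | 0 => littleJacobi A B b 0
  | 1 => littleJacobi A B b 1
  | n + 2 => if Even n then littleJacobi A B b (n + 2) else
      littleJacobi A B b (n + 2) - C (raiseRatio A B b n) * littleJacobi A B b n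

theorem skewJacobi_even (A B b : ℝ) (j : ℕ) :
    skewJacobi A B b (2 * j) = littleJacobi A B b (2 * j) := by
  rcases j with _ | j
  · rfl
  · rw [mul_add, mul_one, skewJacobi, if_pos (even_two_mul j)]

theorem skewJacobi_one (A B b : ℝ) : skewJacobi A B b 1 = littleJacobi A B b 1 := rfl

theorem skewJacobi_odd_succ (A B b : ℝ) (j : ℕ) :
    skewJacobi A B b (2 * (j + 1) + 1) = littleJacobi A B b (2 * (j + 1) + 1) -
      C (raiseRatio A B b (2 * j + 1)) * littleJacobi A B b (2 * j + 1) := by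
  rw [show 2 * (j + 1) + 1 = 2 * j + 1 + 2 by ring, skewJacobi, if_neg]
  simp

namespace IsLatticeWeight

variable {A B b : ℝ} {ρ : ℕ → ℝ} (hW : IsLatticeWeight A B b ρ)
include hW

theorem coeff_zero_ne_zero (n : ℕ) : (littleJacobi A B b n).coeff 0 ≠ 0 := by
  rw [coeff_zero_littleJacobi]
  have h1 := hW.b_pos
  have h2 := qPoch_pos hW.A_lt_one h1.le hW.b_lt_one n
  have h3 := qPoch_mul_mul_pow_div_pos h1 hW.b_lt_one hW.A_pos hW.A_lt_one hW.B_lt_one n n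
    (by tauto)
  positivity

/-- At `x = 0` the operator is multiplication by `1 - A`, so the constant terms of the two-term
expansion determine the ratio of consecutive norms in closed form. -/
theorem raiseCoeff_mul_raiseRatio (n : ℕ) : raiseCoeff A B b (n + 1) * raiseRatio A B b n =
    raiseCoeff A B b n * hW.jacobiNorm (n + 1) / hW.jacobiNorm n := by
  have h := congrArg (fun p => p.coeff 0) (hW.raiseOp_littleJacobi_succ n)
  simp only [coeff_sub, coeff_C_mul, coeff_raiseOp_zero] at h
  have h1 := hW.raiseCoeff_ne_zero (n + 1)
  have h2 := hW.coeff_zero_ne_zero n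
  rw [raiseRatio, h]
  generalize raiseCoeff A B b n * hW.jacobiNorm (n + 1) / hW.jacobiNorm n = K
  field_simp
  ring

theorem jacobiNorm_succ (n : ℕ) : hW.jacobiNorm (n + 1) =
    raiseCoeff A B b (n + 1) * raiseRatio A B b n / raiseCoeff A B b n * hW.jacobiNorm n := by
  rw [hW.raiseCoeff_mul_raiseRatio]
  have h1 := hW.raiseCoeff_ne_zero n
  have h2 := hW.jacobiNorm_ne_zero n
  field_simp

theorem littleJacobi_add_two (n : ℕ) : littleJacobi A B b (n + 2) =
    C (raiseCoeff A B b (n + 1))⁻¹ * raiseOp A B b (littleJacobi A B b (n + 1)) +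
      C (raiseRatio A B b n) * littleJacobi A B b n := by
  rw [hW.raiseOp_littleJacobi_succ, ← hW.raiseCoeff_mul_raiseRatio, C_mul, mul_sub, ← mul_assoc,
    ← C_mul, ← mul_assoc, ← mul_assoc, ← C_mul, inv_mul_cancel₀ (hW.raiseCoeff_ne_zero _), C_1]
  ring

/-- Being in the image of `raiseOp`, the odd members pair with any polynomial through the Jacobi
form. -/
theorem skewJacobi_odd (j : ℕ) : skewJacobi A B b (2 * j + 1) =
    (raiseCoeff A B b (2 * j))⁻¹ • raiseOp A B b (littleJacobi A B b (2 * j)) := by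
  rcases j with _ | j
  · rw [mul_zero, hW.raiseOp_littleJacobi_zero, smul_eq_C_mul, ← mul_assoc, ← C_mul,
      inv_mul_cancel₀ (hW.raiseCoeff_ne_zero _), C_1, one_mul]
    rfl
  · rw [skewJacobi_odd_succ, show 2 * (j + 1) + 1 = 2 * j + 1 + 2 by ring,
      hW.littleJacobi_add_two, add_sub_cancel_right, smul_eq_C_mul]
    rfl

theorem degree_skewJacobi (n : ℕ) : (skewJacobi A B b n).degree = n := by
  rcases Nat.even_or_odd' n with ⟨j, rfl | rfl⟩
  · rw [skewJacobi_even, hW.degree_littleJacobi]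
  · rcases j with _ | j
    · exact hW.degree_littleJacobi 1
    · rw [skewJacobi_odd_succ, degree_sub_eq_left_of_degree_lt, hW.degree_littleJacobi]
      rw [← smul_eq_C_mul]
      refine (degree_smul_le _ _).trans_lt ?_
      rw [hW.degree_littleJacobi, hW.degree_littleJacobi]
      exact_mod_cast (by omega : 2 * j + 1 < 2 * (j + 1) + 1)

theorem monic_skewJacobi (n : ℕ) : (skewJacobi A B b n).Monic := by
  rcases Nat.even_or_odd' n with ⟨j, rfl | rfl⟩
  · rw [skewJacobi_even]; exact hW.monic_littleJacobi _
  · rcases j with _ | j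
    · exact hW.monic_littleJacobi 1
    · rw [skewJacobi_odd_succ]
      refine (hW.monic_littleJacobi _).sub_of_left ?_
      rw [← smul_eq_C_mul]
      refine (degree_smul_le _ _).trans_lt ?_
      rw [hW.degree_littleJacobi, hW.degree_littleJacobi]
      exact_mod_cast (by omega : 2 * j + 1 < 2 * (j + 1) + 1)

theorem skewForm_skewJacobi_odd (f : ℝ[X]) (j : ℕ) : hW.skewForm f (skewJacobi A B b (2 * j + 1)) =
    -((raiseCoeff A B b (2 * j))⁻¹ * hW.jacobiForm f (littleJacobi A B b (2 * j))) := by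
  rw [hW.skewJacobi_odd, map_smul, hW.skewForm_raiseOp, smul_eq_mul, mul_neg]

/-- Modulo `raiseOp` of `p (2i+1)`, the polynomial `p (2i+2)` is a multiple of `p (2i)`, and pairing
`f` with that image is minus the Jacobi form of `f` and `p (2i+1)`. -/
theorem skewForm_even_step {f : ℝ[X]} {i : ℕ}
    (hf : hW.jacobiForm f (littleJacobi A B b (2 * i + 1)) = 0)
    (h : hW.skewForm f (littleJacobi A B b (2 * i)) = 0) :
    hW.skewForm f (littleJacobi A B b (2 * (i + 1))) = 0 := by
  rw [mul_add, mul_one, hW.littleJacobi_add_two, map_add, ← smul_eq_C_mul, ← smul_eq_C_mul,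
    map_smul, map_smul, hW.skewForm_raiseOp, h, hf]
  simp

theorem skewForm_even_even (i j : ℕ) :
    hW.skewForm (skewJacobi A B b (2 * i)) (skewJacobi A B b (2 * j)) = 0 := by
  rw [skewJacobi_even, skewJacobi_even]
  have h0 : ∀ i, hW.skewForm (littleJacobi A B b 0) (littleJacobi A B b (2 * i)) = 0 := by
    intro i
    induction i with
    | zero => exact hW.skewForm_self _
    | succ i ih => exact hW.skewForm_even_step (hW.jacobiForm_littleJacobi_of_ne (by omega)) ih
  induction j with
  | zero => rw [hW.skewForm_swap, mul_zero, h0, neg_zero]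
  | succ j ih => exact hW.skewForm_even_step (hW.jacobiForm_littleJacobi_of_ne (by omega)) ih

theorem skewForm_even_odd (i j : ℕ) :
    hW.skewForm (skewJacobi A B b (2 * i)) (skewJacobi A B b (2 * j + 1)) =
      if i = j then -((raiseCoeff A B b (2 * i))⁻¹ * hW.jacobiNorm (2 * i)) else 0 := by
  rw [hW.skewForm_skewJacobi_odd, skewJacobi_even]
  split_ifs with h
  · rw [h]; rfl
  · rw [hW.jacobiForm_littleJacobi_of_ne (by omega), mul_zero, neg_zero]

/-- The left argument involves only odd `p k`, which are Jacobi orthogonal to the `p (2j)` from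
which the right argument is raised. -/
theorem skewForm_odd_odd (i j : ℕ) :
    hW.skewForm (skewJacobi A B b (2 * i + 1)) (skewJacobi A B b (2 * j + 1)) = 0 := by
  rw [hW.skewForm_skewJacobi_odd]
  rcases i with _ | i
  · rw [mul_zero, zero_add, skewJacobi_one, hW.jacobiForm_littleJacobi_of_ne (by omega)]
    simp
  · rw [skewJacobi_odd_succ, map_sub, ← smul_eq_C_mul, map_smul, LinearMap.sub_apply,
      LinearMap.smul_apply, hW.jacobiForm_littleJacobi_of_ne (by omega),
      hW.jacobiForm_littleJacobi_of_ne (by omega)]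
    simp

theorem skewForm_norm_ne_zero (i : ℕ) :
    -((raiseCoeff A B b (2 * i))⁻¹ * hW.jacobiNorm (2 * i)) ≠ 0 :=
  neg_ne_zero.2 (mul_ne_zero (inv_ne_zero (hW.raiseCoeff_ne_zero _)) (hW.jacobiNorm_ne_zero _))

/-- The skew form is nondegenerate on the polynomials of degree less than `2j`. -/
theorem eq_zero_of_skewForm {f : ℝ[X]} {j : ℕ} (hf : f.degree < (2 * j : ℕ))
    (h : ∀ k < 2 * j, hW.skewForm f (skewJacobi A B b k) = 0) : f = 0 := by
  have hd := hW.degree_skewJacobi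
  by_contra hne
  have hn : f.natDegree < 2 * j := (natDegree_lt_iff_degree_lt hne).2 hf
  set c := f.leadingCoeff with hc
  have hc0 : c ≠ 0 := leadingCoeff_ne_zero.2 hne
  obtain ⟨r, hr, hfr⟩ : ∃ r : ℝ[X], r.degree < f.natDegree ∧
      f = c • skewJacobi A B b f.natDegree + r := by
    refine ⟨f - c • skewJacobi A B b f.natDegree, ?_, by simp⟩
    rw [← degree_eq_natDegree hne, smul_eq_C_mul]
    refine degree_sub_lt_left ?_ hne ?_
    · rw [degree_C_mul hc0, hd, degree_eq_natDegree hne]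
    · rw [leadingCoeff_mul, leadingCoeff_C, (hW.monic_skewJacobi _).leadingCoeff, mul_one]
  -- Pairing with the partner of the leading member, `2i + 1` for `2i` and conversely, isolates the
  -- leading coefficient. The even bound `2 * j` keeps the partner within range.
  rcases Nat.even_or_odd' f.natDegree with ⟨i, hi | hi⟩
  · have h1 := h (2 * i + 1) (by omega)
    have h2 : hW.skewForm r (skewJacobi A B b (2 * i + 1)) = 0 := by
      rw [hW.skewForm_skewJacobi_odd, hW.jacobiForm_eq_zero_of_degree_lt (by rwa [← hi]), mul_zero,
        neg_zero]
    rw [hfr, hi, map_add, map_smul, LinearMap.add_apply, LinearMap.smul_apply, h2, add_zero,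
      hW.skewForm_even_odd, if_pos rfl, smul_eq_mul] at h1
    exact mul_ne_zero hc0 (hW.skewForm_norm_ne_zero i) h1
  · have h1 := h (2 * i) (by omega)
    have h2 : hW.skewForm (skewJacobi A B b (2 * i)) r = 0 := by
      refine apply_eq_zero_of_monic_family hd (n := 2 * i + 1) _ (fun k hk => ?_) (by rwa [← hi])
      rcases Nat.even_or_odd' k with ⟨l, rfl | rfl⟩
      · exact hW.skewForm_even_even _ _
      · rw [hW.skewForm_even_odd, if_neg (by omega)]
    rw [hW.skewForm_swap, hfr, hi, map_add, map_smul, h2, add_zero,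
      hW.skewForm_even_odd, if_pos rfl, smul_eq_mul] at h1
    exact mul_ne_zero hc0 (hW.skewForm_norm_ne_zero i) (neg_eq_zero.1 h1)

theorem degree_sub_skewJacobi_lt {Q : ℝ[X]} {n : ℕ} (hQ : Q.Monic) (hd : Q.natDegree = n) :
    (Q - skewJacobi A B b n).degree < n := by
  rw [← hd, ← degree_eq_natDegree hQ.ne_zero]
  refine degree_sub_lt_left ?_ hQ.ne_zero ?_
  · rw [hW.degree_skewJacobi, degree_eq_natDegree hQ.ne_zero]
  · rw [(hW.monic_skewJacobi _).leadingCoeff, hQ.leadingCoeff]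

/-- Skew orthogonality determines the family up to adding multiples of `Q (2j)` to `Q (2j+1)`, and
the normalization removes this freedom. -/
theorem eq_skewJacobi {Q : ℕ → ℝ[X]} (hm : ∀ n, (Q n).Monic) (hd : ∀ n, (Q n).natDegree = n)
    (hee : ∀ i j, hW.skewForm (Q (2 * i)) (Q (2 * j)) = 0)
    (hoo : ∀ i j, hW.skewForm (Q (2 * i + 1)) (Q (2 * j + 1)) = 0)
    (heo : ∀ i j, i ≠ j → hW.skewForm (Q (2 * i)) (Q (2 * j + 1)) = 0)
    (hnorm : IsNormalizedAgainst (littleJacobi A B b) Q) (n : ℕ) : Q n = skewJacobi A B b n := by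
  have hdeg : ∀ n, (Q n).degree = n := fun n => by rw [degree_eq_natDegree (hm n).ne_zero, hd]
  -- Both members of the pair `2j, 2j+1` are skew orthogonal to every polynomial of degree below
  -- `2j`. Differences of two such families inherit this.
  have hlow : ∀ j k, 2 * j ≤ k → k < 2 * j + 2 → ∀ f : ℝ[X], f.degree < (2 * j : ℕ) →
      hW.skewForm (Q k) f = 0 := by
    intro j k hk hk' f hf
    refine apply_eq_zero_of_monic_family hdeg _ (fun i hi => ?_) hf
    obtain rfl | rfl : k = 2 * j ∨ k = 2 * j + 1 := by omega
    all_goals rcases Nat.even_or_odd' i with ⟨l, rfl | rfl⟩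
    · exact hee _ _
    · exact heo _ _ (by omega)
    · rw [hW.skewForm_swap, heo _ _ (by omega), neg_zero]
    · exact hoo _ _
  have hlow' : ∀ j k, 2 * j ≤ k → k < 2 * j + 2 → ∀ f : ℝ[X], f.degree < (2 * j : ℕ) →
      hW.skewForm (skewJacobi A B b k) f = 0 := by
    intro j k hk hk' f hf
    refine apply_eq_zero_of_monic_family hW.degree_skewJacobi _ (fun i hi => ?_) hf
    obtain rfl | rfl : k = 2 * j ∨ k = 2 * j + 1 := by omega
    all_goals rcases Nat.even_or_odd' i with ⟨l, rfl | rfl⟩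
    · exact hW.skewForm_even_even _ _
    · rw [hW.skewForm_even_odd, if_neg (by omega)]
    · rw [hW.skewForm_swap, hW.skewForm_even_odd, if_neg (by omega), neg_zero]
    · exact hW.skewForm_odd_odd _ _
  have hsk : ∀ j, ∀ k < 2 * j, (skewJacobi A B b k).degree < (2 * j : ℕ) := fun j k hk => by
    rw [hW.degree_skewJacobi]; exact_mod_cast hk
  rcases Nat.even_or_odd' n with ⟨j, rfl | rfl⟩
  · rw [← sub_eq_zero]
    refine hW.eq_zero_of_skewForm (hW.degree_sub_skewJacobi_lt (hm _) (hd _)) fun k hk => ?_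
    rw [map_sub, LinearMap.sub_apply, hlow j _ le_rfl (by omega) _ (hsk j k hk),
      hlow' j _ le_rfl (by omega) _ (hsk j k hk), sub_zero]
  · have hD := hW.degree_sub_skewJacobi_lt (hm (2 * j + 1)) (hd _)
    set D := Q (2 * j + 1) - skewJacobi A B b (2 * j + 1) with hDdef
    set x := D.coeff (2 * j) with hx
    -- `D` may have degree `2j`, outside the range of nondegeneracy, so its top coefficient is
    -- removed first. What remains is exactly the freedom that the normalization has to exclude.
    have hE : D - x • skewJacobi A B b (2 * j) = 0 := by
      refine hW.eq_zero_of_skewForm (j := j) ?_ fun k hk => ?_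
      · rw [degree_lt_iff_coeff_zero]
        intro m hm
        rcases hm.eq_or_lt with rfl | hm
        · rw [coeff_sub, coeff_smul, skewJacobi_even, hW.coeff_littleJacobi_self, smul_eq_mul,
            mul_one, sub_self]
        · rw [coeff_sub, coeff_smul, (degree_lt_iff_coeff_zero _ _).1 hD m (by omega),
            coeff_eq_zero_of_degree_lt (p := skewJacobi A B b (2 * j)) (n := m)
              (by rw [hW.degree_skewJacobi]; exact_mod_cast hm), smul_zero, sub_zero]
      · rw [map_sub, map_smul, LinearMap.sub_apply, LinearMap.smul_apply, hDdef, map_sub,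
          LinearMap.sub_apply, hlow j _ (by omega) (by omega) _ (hsk j k hk),
          hlow' j _ (by omega) (by omega) _ (hsk j k hk),
          hlow' j _ le_rfl (by omega) _ (hsk j k hk)]
        simp
    have hspan : ∀ f ∈ Submodule.span ℝ (littleJacobi A B b '' {k | k ≠ 2 * j}),
        hW.jacobiForm f (littleJacobi A B b (2 * j)) = 0 := by
      intro f hf
      refine Submodule.span_induction ?_ ?_ ?_ ?_ hf
      · rintro _ ⟨k, hk, rfl⟩
        exact hW.jacobiForm_littleJacobi_of_ne hk
      · simp
      · intro f g _ _ hf hg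
        rw [map_add, LinearMap.add_apply, hf, hg, add_zero]
      · intro c f _ hf
        rw [map_smul, LinearMap.smul_apply, hf, smul_zero]
    -- Both odd polynomials are Jacobi orthogonal to `p (2j)`: `Q (2j+1)` by normalization, the
    -- explicit one because its skew form with itself vanishes. Hence `x = 0`.
    have h1 := hspan _ (hnorm j)
    have h2 : hW.jacobiForm (skewJacobi A B b (2 * j + 1)) (littleJacobi A B b (2 * j)) = 0 := by
      have := hW.skewForm_skewJacobi_odd (skewJacobi A B b (2 * j + 1)) j
      rw [hW.skewForm_self, eq_comm, neg_eq_zero] at this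
      exact (mul_eq_zero.1 this).resolve_left (inv_ne_zero (hW.raiseCoeff_ne_zero _))
    have h3 : hW.jacobiForm D (littleJacobi A B b (2 * j)) = 0 := by
      rw [hDdef, map_sub, LinearMap.sub_apply, h1, h2, sub_zero]
    rw [sub_eq_zero] at hE
    rw [hE, map_smul, LinearMap.smul_apply, skewJacobi_even, smul_eq_mul] at h3
    have hx0 : x = 0 := (mul_eq_zero.1 h3).resolve_right (hW.jacobiNorm_ne_zero _)
    rw [hx0, zero_smul] at hE
    exact sub_eq_zero.1 hE

omit hW in
theorem skewJacobi_isNormalizedAgainst (A B b : ℝ) :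
    IsNormalizedAgainst (littleJacobi A B b) (skewJacobi A B b) := by
  have hmem : ∀ j k : ℕ, k ≠ 2 * j → littleJacobi A B b k ∈
      Submodule.span ℝ (littleJacobi A B b '' {k | k ≠ 2 * j}) := fun j k hk =>
    Submodule.subset_span ⟨k, hk, rfl⟩
  rintro (_ | j)
  · exact hmem _ _ (by omega)
  · rw [skewJacobi_odd_succ, ← smul_eq_C_mul]
    exact Submodule.sub_mem _ (hmem _ _ (by omega)) (Submodule.smul_mem _ _ (hmem _ _ (by omega)))

end IsLatticeWeight

/-! ### Closed forms of the raising coefficients and norms -/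

/-- The denominator `(A B b^{n-1};b)_n` of the little `q`-Jacobi polynomials. -/
def jacobiDenom (A B b : ℝ) (n : ℕ) : ℝ := qPoch (A * B * b ^ n / b) b n

theorem jacobiDenom_zero (A B b : ℝ) : jacobiDenom A B b 0 = 1 := by simp [jacobiDenom, qPoch]

theorem jacobiDenom_succ {A B b : ℝ} (hb : b ≠ 0) (n : ℕ) :
    jacobiDenom A B b (n + 1) = qPoch (A * B * b ^ n) b (n + 1) := by
  rw [jacobiDenom, pow_succ, ← mul_assoc, mul_div_cancel_right₀ _ hb]

theorem jacobiDenom_succ_succ {A B b : ℝ} (hb : b ≠ 0) (n : ℕ) :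
    jacobiDenom A B b (n + 2) * (1 - A * B * b ^ n) =
      jacobiDenom A B b (n + 1) * (1 - A * B * b ^ (2 * n + 1)) * (1 - A * B * b ^ (2 * n + 2)) := by
  rw [jacobiDenom_succ hb, jacobiDenom_succ hb, mul_comm, qPoch_succ, qPoch_succ,
    qPoch_succ' (A * B * b ^ n)]
  ring_nf

theorem jacobiNorm_step_aux {t u v d e : ℝ} (hd : d ≠ 0) (he : e ≠ 0) (ht : t ≠ 0) (hu : u ≠ 0)
    (hv : v ≠ 0) (A z f g h c a y k l m : ℝ) :
    A * z * f * g * h / (t * u) * (d / e) * (c * (a * y * (k * l * m) / (d * v))) =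
      c * (a * A * (y * z) * (k * f * (l * g) * (m * h)) / (e * (v * t * u))) := by
  rw [div_mul_div_comm, mul_div_assoc', div_mul_div_comm, mul_div_assoc', div_eq_div_iff
    (by positivity) (by positivity)]
  ring

namespace IsLatticeWeight

variable {A B b : ℝ} {ρ : ℕ → ℝ} (hW : IsLatticeWeight A B b ρ)
include hW

theorem jacobiDenom_pos (n : ℕ) : 0 < jacobiDenom A B b n :=
  qPoch_mul_mul_pow_div_pos hW.b_pos hW.b_lt_one hW.A_pos hW.A_lt_one hW.B_lt_one n n (by tauto)

theorem one_sub_mul_ne_zero (k : ℕ) : 1 - A * B * b ^ k ≠ 0 :=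
  (sub_pos.2 (hW.mul_mul_pow_lt_one k)).ne'

theorem coeff_zero_succ (n : ℕ) : (littleJacobi A B b (n + 1)).coeff 0 =
    -(b ^ n * (1 - A * b ^ n) * (jacobiDenom A B b n / jacobiDenom A B b (n + 1))) *
      (littleJacobi A B b n).coeff 0 := by
  have h1 := (hW.jacobiDenom_pos n).ne'
  have h2 := (hW.jacobiDenom_pos (n + 1)).ne'
  rw [coeff_zero_littleJacobi, coeff_zero_littleJacobi, ← jacobiDenom, ← jacobiDenom,
    Nat.triangle_succ, qPoch_succ, pow_succ (-1 : ℝ),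
    pow_add b (n * (n - 1) / 2)]
  generalize b ^ (n * (n - 1) / 2) = y
  field_simp

/-- The quotient of denominators stays unreduced: its simplified form has the factor `1 - A B
b^(n-1)` above and `1 - A B b^(2n-1)` below, and for `n = 0` both may vanish. -/
theorem raiseRatio_eq (n : ℕ) : raiseRatio A B b n =
    A * b ^ (2 * n + 1) * (1 - A * b ^ n) * (1 - B * b ^ n) * (1 - b ^ (n + 1)) /
      ((1 - A * B * b ^ (2 * n + 1)) * (1 - A * B * b ^ (2 * n + 2))) *
      (jacobiDenom A B b n / jacobiDenom A B b (n + 1)) := by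
  have h0 := hW.coeff_zero_ne_zero n
  have h1 := hW.raiseCoeff_ne_zero (n + 1)
  have hb := hW.b_pos.ne'
  have h3 := hW.one_sub_mul_ne_zero (2 * n + 1)
  have h4 := hW.one_sub_mul_ne_zero (2 * n + 2)
  have hδ : jacobiDenom A B b (n + 1) / jacobiDenom A B b (n + 2) = (1 - A * B * b ^ n) /
      ((1 - A * B * b ^ (2 * n + 1)) * (1 - A * B * b ^ (2 * n + 2))) := by
    rw [div_eq_div_iff (hW.jacobiDenom_pos _).ne' (mul_ne_zero h3 h4)]
    linear_combination -jacobiDenom_succ_succ (A := A) (B := B) hb n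
  rw [raiseRatio, div_eq_iff (mul_ne_zero h1 h0), hW.coeff_zero_succ (n + 1),
    hW.coeff_zero_succ n, hδ, raiseCoeff, show 2 * (n + 1) = 2 * n + 2 by ring]
  generalize jacobiDenom A B b n / jacobiDenom A B b (n + 1) = δ
  generalize (littleJacobi A B b n).coeff 0 = π
  rw [show b ^ (n + 1) = b * b ^ n by ring]
  have h5 : b ^ (2 * n + 1) = b * (b ^ n) ^ 2 := by ring
  have h6 : b ^ (2 * n + 2) = b ^ 2 * (b ^ n) ^ 2 := by ring
  rw [h5] at h3 ⊢
  rw [h6] at h4 ⊢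
  have hx : b ^ n ≠ 0 := pow_ne_zero _ hb
  generalize b ^ n = x at *
  obtain ⟨u, hu⟩ : ∃ u, u = 1 - A * B * (b * x ^ 2) := ⟨_, rfl⟩
  obtain ⟨v, hv⟩ : ∃ v, v = 1 - A * B * (b ^ 2 * x ^ 2) := ⟨_, rfl⟩
  rw [← hu] at h3 ⊢
  rw [← hv] at h4 ⊢
  field_simp
  rw [hu]
  ring

theorem jacobiNorm_succ' (n : ℕ) : hW.jacobiNorm (n + 1) =
    A * b ^ (2 * n) * (1 - A * b ^ n) * (1 - B * b ^ n) * (1 - b * b ^ n) /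
      ((1 - A * B * b ^ (2 * n)) * (1 - A * B * b ^ (2 * n + 1))) *
      (jacobiDenom A B b n / jacobiDenom A B b (n + 1)) * hW.jacobiNorm n := by
  have h2 := hW.one_sub_mul_ne_zero (2 * n)
  have h3 := hW.one_sub_mul_ne_zero (2 * n + 1)
  have h4 := hW.one_sub_mul_ne_zero (2 * n + 2)
  have hb := hW.b_pos.ne'
  have hx : b ^ n ≠ 0 := pow_ne_zero _ hb
  rw [hW.jacobiNorm_succ, hW.raiseRatio_eq, raiseCoeff, raiseCoeff,
    show 2 * (n + 1) = 2 * n + 2 by ring]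
  congr 1
  generalize jacobiDenom A B b n / jacobiDenom A B b (n + 1) = δ
  have h7 : b ^ (n + 1) = b * b ^ n := by ring
  have h5 : b ^ (2 * n + 1) = b * (b ^ n) ^ 2 := by ring
  have h6 : b ^ (2 * n + 2) = b ^ 2 * (b ^ n) ^ 2 := by ring
  have h8 : b ^ (2 * n) = (b ^ n) ^ 2 := by ring
  rw [h5] at h3 ⊢
  rw [h6] at h4 ⊢
  rw [h8] at h2 ⊢
  rw [h7]
  generalize b ^ n = x at *
  generalize 1 - A * B * x ^ 2 = t at *
  generalize 1 - A * B * (b * x ^ 2) = u at *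
  generalize 1 - A * B * (b ^ 2 * x ^ 2) = v at *
  field_simp

theorem jacobiNorm_eq (n : ℕ) : hW.jacobiNorm n = hW.jacobiNorm 0 * (A ^ n * b ^ (n * (n - 1)) *
    (qPoch A b n * qPoch B b n * qPoch b b n) /
      (jacobiDenom A B b n * qPoch (A * B) b (2 * n))) := by
  induction n with
  | zero => simp [qPoch, jacobiDenom_zero]
  | succ n ih =>
    have h1 := (hW.jacobiDenom_pos n).ne'
    have h2 := (hW.jacobiDenom_pos (n + 1)).ne'
    have h3 := hW.one_sub_mul_ne_zero (2 * n)
    have h4 := hW.one_sub_mul_ne_zero (2 * n + 1)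
    have h5 : qPoch (A * B) b (2 * n) ≠ 0 :=
      (qPoch_pos (by simpa using hW.mul_mul_pow_lt_one 0) hW.b_pos.le hW.b_lt_one _).ne'
    have h6 : b ^ ((n + 1) * (n + 1 - 1)) = b ^ (n * (n - 1)) * b ^ (2 * n) := by
      rw [← pow_add]
      congr 1
      rcases n with _ | n
      · simp
      · simp only [Nat.add_sub_cancel]; ring
    rw [hW.jacobiNorm_succ', ih, mul_add, mul_one, qPoch_succ, qPoch_succ, qPoch_succ, qPoch_succ,
      qPoch_succ, h6, pow_succ A]
    exact jacobiNorm_step_aux h1 h2 h3 h4 h5 _ _ _ _ _ _ _ _ _ _ _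

end IsLatticeWeight

/-! ### The concrete lattice weight -/

/-- The lattice weight of the skew inner product, with `r = b^{(α+1)/2}`. -/
def qBetaWeight (r B b : ℝ) (m : ℕ) : ℝ :=
  r ^ m * (qPochInf (b ^ (m + 2)) (b ^ 2) / qPochInf (B * b ^ m) (b ^ 2))

section

variable {r B b : ℝ} (hb0 : 0 < b) (hb1 : b < 1) (hr0 : 0 < r) (hr1 : r < 1) (hB0 : 0 < B)
  (hB1 : B < 1)
include hb0 hb1 hr0 hr1 hB0 hB1

/-- A shift of the index by two peels one factor off each infinite product in base `b ^ 2`. The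
quotient of products is bounded, so summability comes from the geometric factor `r ^ m`. -/
theorem isLatticeWeight_qBetaWeight : IsLatticeWeight (r ^ 2) B b (qBetaWeight r B b) := by
  have h20 : (0 : ℝ) ≤ b ^ 2 := by positivity
  have h21 : b ^ 2 < 1 := pow_lt_one₀ hb0.le hb1 two_ne_zero
  have hBm : ∀ m, B * b ^ m < 1 := mul_pow_lt_one hB1 hb0.le hb1
  have hbm : ∀ m, b ^ (m + 2) < 1 := fun m => pow_lt_one₀ hb0.le hb1 (by omega)
  have hpos : ∀ m, 0 < qBetaWeight r B b m := fun m => mul_pos (by positivity)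
    (div_pos (qPochInf_pos (hbm m) h20 h21) (qPochInf_pos (hBm m) h20 h21))
  refine ⟨hb0, hb1, by positivity, pow_lt_one₀ hr0.le hr1 two_ne_zero, hB0, hB1, hpos,
    fun m => ?_, ?_⟩
  · have h1 := (qPochInf_pos (hBm m) h20 h21).ne'
    have h2 := (qPochInf_pos (hBm (m + 2)) h20 h21).ne'
    have h3 : qPochInf (b ^ (m + 2)) (b ^ 2) =
        (1 - b ^ (m + 2)) * qPochInf (b ^ (m + 2 + 2)) (b ^ 2) := by
      rw [qPochInf_eq_mul _ h20 h21, ← pow_add]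
    have h4 : qPochInf (B * b ^ m) (b ^ 2) =
        (1 - B * b ^ m) * qPochInf (B * b ^ (m + 2)) (b ^ 2) := by
      rw [qPochInf_eq_mul _ h20 h21, mul_assoc, ← pow_add]
    have h5 : 1 - B * b ^ m ≠ 0 := (sub_pos.2 (hBm m)).ne'
    rw [qBetaWeight, qBetaWeight, h3, h4, pow_add r]
    field_simp
  · refine Summable.of_nonneg_of_le (fun m => (hpos m).le) (fun m => ?_)
      ((summable_geometric_of_lt_one hr0.le hr1).mul_right (1 / qPochInf B (b ^ 2)))
    refine mul_le_mul_of_nonneg_left ?_ (by positivity)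
    exact div_le_div₀ zero_le_one (qPochInf_le_one (by positivity) (hbm m) h20 h21)
      (qPochInf_pos hB1 h20 h21)
      (qPochInf_anti (mul_le_of_le_one_right hB0.le (pow_le_one₀ hb0.le hb1.le)) hB1 h20 h21)

omit hr0 hr1 hB0 in
-- The base `b ^ 2` products at neighbouring points are the even and odd factors of one product in
-- base `b`. The result is a summand of the q-binomial series at `z = r ^ 2`, which evaluates the
-- zeroth norm.
theorem jacobiWeight_qBetaWeight (m : ℕ) : jacobiWeight b (qBetaWeight r B b) m =
    r * (qPochInf b b / qPochInf B b) * (qPoch B b m / qPoch b b m * (r ^ 2) ^ m) := by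
  have h1 : qPochInf b b = qPoch b b m * ((1 - b ^ (m + 1)) *
      (qPochInf (b ^ (m + 2)) (b ^ 2) * qPochInf (b ^ (m + 1 + 2)) (b ^ 2))) := by
    rw [qPochInf_eq_qPoch_mul b hb0.le hb1 m, ← pow_succ', qPochInf_eq_mul _ hb0.le hb1,
      ← pow_succ, ← qPochInf_sq_mul _ hb0.le hb1, ← pow_succ]
  have h2 : qPochInf B b = qPoch B b m *
      (qPochInf (B * b ^ m) (b ^ 2) * qPochInf (B * b ^ (m + 1)) (b ^ 2)) := by
    rw [qPochInf_eq_qPoch_mul B hb0.le hb1 m, ← qPochInf_sq_mul _ hb0.le hb1, mul_assoc B, ← pow_succ]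
  have h3 := (qPoch_pos hb1 hb0.le hb1 m).ne'
  have h4 := (qPoch_pos hB1 hb0.le hb1 m).ne'
  rw [h1, h2, jacobiWeight, qBetaWeight, qBetaWeight]
  field_simp
  ring

omit hr0 hr1 in
theorem jacobiNorm_zero_qBetaWeight (h : IsLatticeWeight (r ^ 2) B b (qBetaWeight r B b)) :
    h.jacobiNorm 0 =
      r * (qPochInf b b * qPochInf (r ^ 2 * B) b / (qPochInf B b * qPochInf (r ^ 2) b)) := by
  have h0 : littleJacobi (r ^ 2) B b 0 = 1 := by simp [littleJacobi, qPoch]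
  rw [IsLatticeWeight.jacobiNorm, h.jacobiForm_apply, h0]
  simp only [eval_one, one_mul, jacobiWeight_qBetaWeight hb0 hb1 hB1]
  rw [tsum_mul_left, qBinomial hB0.le hB1 hb0.le hb1 h.A_pos.le h.A_lt_one, mul_comm B]
  rw [mul_assoc, div_mul_div_comm]

end

/-! ### Translation into the parameters α, β, q -/

section rpow

variable {b : ℝ} (hb : 0 < b)
include hb

theorem sq_rpow (x : ℝ) : (b ^ 2) ^ x = b ^ (2 * x) := by
  rw [Real.rpow_mul hb.le, Real.rpow_two]

theorem sq_rpow_half : (b ^ 2) ^ (1 / 2 : ℝ) = b := by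
  rw [sq_rpow hb, mul_one_div_cancel two_ne_zero, Real.rpow_one]

theorem rpow_eq_mul_pow {x y : ℝ} (k : ℕ) (h : x = y + k) : b ^ x = b ^ y * b ^ k := by
  rw [h, Real.rpow_add hb, Real.rpow_natCast]

theorem rpow_eq_mul_mul_pow {x α β : ℝ} (k : ℕ) (h : x = α + β + 2 + k) :
    b ^ x = b ^ (α + 1) * b ^ (β + 1) * b ^ k := by
  rw [rpow_eq_mul_pow hb k h, ← Real.rpow_add hb]
  ring_nf

theorem rpow_eq_mul_mul_pow_div (α β : ℝ) (n : ℕ) :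
    b ^ (α + β + n + 1) = b ^ (α + 1) * b ^ (β + 1) * b ^ n / b := by
  rw [eq_div_iff hb.ne', ← Real.rpow_add_one hb.ne']
  exact rpow_eq_mul_mul_pow hb n (by ring)

theorem monicLittleQJacobi_eq (α β : ℝ) (n : ℕ) :
    monicLittleQJacobi α β b n = littleJacobi (b ^ (α + 1)) (b ^ (β + 1)) b n := by
  rw [monicLittleQJacobi, littleJacobi, rpow_eq_mul_mul_pow_div hb, Real.rpow_neg hb.le,
    Real.rpow_natCast]

end rpow

section weight

variable {b α β : ℝ}

theorem isLatticeWeight_of_parameters (hb0 : 0 < b) (hb1 : b < 1) (hα : -1 < α) (hβ : -1 < β) :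
    IsLatticeWeight (b ^ (α + 1)) (b ^ (β + 1)) b
      (qBetaWeight (b ^ ((α + 1) / 2)) (b ^ (β + 1)) b) := by
  have h := isLatticeWeight_qBetaWeight (r := b ^ ((α + 1) / 2)) hb0 hb1 (by positivity)
    (Real.rpow_lt_one hb0.le hb1 (by linarith)) (Real.rpow_pos_of_pos hb0 (β + 1))
    (Real.rpow_lt_one hb0.le hb1 (by linarith))
  rwa [← Real.rpow_two, ← Real.rpow_mul hb0.le, div_mul_cancel₀ _ two_ne_zero] at h

/-- The last factor `b ^ m` is the lattice point from Jackson's measure; it raises the exponent from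
`(α-1)/2` to `(α+1)/2`. -/
theorem mul_weight_eq_qBetaWeight (hb0 : 0 < b) (m : ℕ) :
    (b ^ m) ^ ((α - 1) / 2) * qPochReal (b ^ 2 * b ^ m) (b ^ 2) ((β - 1) / 2) * b ^ m =
      qBetaWeight (b ^ ((α + 1) / 2)) (b ^ (β + 1)) b m := by
  have h1 : (b ^ m) ^ ((α - 1) / 2) * b ^ m = (b ^ ((α + 1) / 2)) ^ m := by
    rw [← Real.rpow_add_one (pow_ne_zero _ hb0.ne'), ← Real.rpow_natCast, ← Real.rpow_natCast,
      ← Real.rpow_mul hb0.le, ← Real.rpow_mul hb0.le]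
    ring_nf
  have h2 : b ^ 2 * b ^ m * (b ^ 2) ^ ((β - 1) / 2) = b ^ (β + 1) * b ^ m := by
    rw [sq_rpow hb0, show β + 1 = 2 * ((β - 1) / 2) + (2 : ℕ) by push_cast; ring,
      Real.rpow_add hb0, Real.rpow_natCast]
    ring
  rw [qBetaWeight, qPochReal, h2, ← h1, ← pow_add, add_comm 2 m]
  ring

theorem mul_skewWeight_eq (hb0 : 0 < b) (m : ℕ) :
    b ^ m * skewWeight α β (b ^ 2) (b ^ m) =
      (b ^ 2) ^ (-(α + 1) / 8) * qBetaWeight (b ^ ((α + 1) / 2)) (b ^ (β + 1)) b m := by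
  rw [← mul_weight_eq_qBetaWeight hb0, skewWeight]
  ring

theorem skewInnerTerm_eq (hb0 : 0 < b) (φ ψ : ℝ → ℝ) (k l : ℕ) :
    skewInnerTerm (b ^ 2) (skewWeight α β (b ^ 2)) φ ψ k l = ((b ^ 2) ^ (-(α + 1) / 8)) ^ 2 *
      ((fun m => ψ (b ^ m) * qBetaWeight (b ^ ((α + 1) / 2)) (b ^ (β + 1)) b m) (2 * k) *
        (fun m => φ (b ^ m) * qBetaWeight (b ^ ((α + 1) / 2)) (b ^ (β + 1)) b m)
          (2 * k + 2 * l + 1) -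
      (fun m => φ (b ^ m) * qBetaWeight (b ^ ((α + 1) / 2)) (b ^ (β + 1)) b m) (2 * k) *
        (fun m => ψ (b ^ m) * qBetaWeight (b ^ ((α + 1) / 2)) (b ^ (β + 1)) b m)
          (2 * k + 2 * l + 1)) := by
  have hx : b * b ^ (2 * k) * b ^ (2 * l) = b ^ (2 * k + 2 * l + 1) := by ring
  have h1 := mul_skewWeight_eq (α := α) (β := β) hb0 (2 * k)
  have h2 := mul_skewWeight_eq (α := α) (β := β) hb0 (2 * k + 2 * l + 1)
  simp only [skewInnerTerm, sq_rpow_half hb0, ← pow_mul, hx]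
  generalize qBetaWeight (b ^ ((α + 1) / 2)) (b ^ (β + 1)) b (2 * k) = u at *
  generalize qBetaWeight (b ^ ((α + 1) / 2)) (b ^ (β + 1)) b (2 * k + 2 * l + 1) = v at *
  generalize b ^ (2 * k + 2 * l + 1) = x at *
  generalize b ^ (2 * k) = y at *
  have h3 : ((b ^ 2) ^ (-(α + 1) / 8)) ^ 2 * (u * v) =
      (y * skewWeight α β (b ^ 2) y) * (x * skewWeight α β (b ^ 2) x) := by
    rw [h1, h2]; ring
  linear_combination (-(φ x * ψ y - φ y * ψ x)) * h3

theorem summable_skewInnerTerm (hb0 : 0 < b) (hb1 : b < 1) (hα : -1 < α) (hβ : -1 < β)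
    (φ ψ : ℝ[X]) : Summable fun kl : ℕ × ℕ => skewInnerTerm (b ^ 2) (skewWeight α β (b ^ 2))
      (fun x => φ.eval x) (fun x => ψ.eval x) kl.1 kl.2 := by
  have hs := (isLatticeWeight_of_parameters hb0 hb1 hα hβ).summable_lattice
  simp_rw [skewInnerTerm_eq hb0]
  exact ((summable_evenOdd (hs ψ) (hs φ)).sub (summable_evenOdd (hs φ) (hs ψ))).mul_left _

theorem skewInner_eq (hb0 : 0 < b) (hb1 : b < 1) (hα : -1 < α) (hβ : -1 < β) (φ ψ : ℝ[X]) :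
    skewInner (b ^ 2) (skewWeight α β (b ^ 2)) (fun x => φ.eval x) (fun x => ψ.eval x) =
      (1 - b ^ 2) ^ 2 * ((b ^ 2) ^ (-(α + 1) / 8)) ^ 2 *
        (isLatticeWeight_of_parameters hb0 hb1 hα hβ).skewForm φ ψ := by
  have hs := (isLatticeWeight_of_parameters hb0 hb1 hα hβ).summable_lattice
  have h1 : skewInner (b ^ 2) (skewWeight α β (b ^ 2)) (fun x => φ.eval x) (fun x => ψ.eval x) =
      (1 - b ^ 2) ^ 2 * ∑' kl : ℕ × ℕ, skewInnerTerm (b ^ 2) (skewWeight α β (b ^ 2))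
      (fun x => φ.eval x) (fun x => ψ.eval x) kl.1 kl.2 := by
    rw [(summable_skewInnerTerm hb0 hb1 hα hβ φ ψ).tsum_prod, skewInner, jackson, sq (1 - b ^ 2), mul_assoc]
    congr 1
    rw [← tsum_mul_left]
    refine tsum_congr fun k => ?_
    rw [jackson, mul_left_comm]
    congr 1
    rw [← tsum_mul_left]
    refine tsum_congr fun l => ?_
    simp only [skewInnerTerm, one_mul]
    ring
  rw [h1, mul_assoc]
  congr 1
  simp_rw [skewInnerTerm_eq hb0]
  rw [tsum_mul_left, (summable_evenOdd (hs ψ) (hs φ)).tsum_sub (summable_evenOdd (hs φ) (hs ψ))]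
  rfl

theorem isSkewOrthogonal_and_normalized_iff (hb0 : 0 < b) (hb1 : b < 1) (hα : -1 < α)
    (hβ : -1 < β) (Q : ℕ → ℝ[X]) :
    (IsSkewOrthogonal (b ^ 2) (skewWeight α β (b ^ 2)) Q ∧
      IsNormalizedAgainst (monicLittleQJacobi α β b) Q) ↔
    Q = skewJacobi (b ^ (α + 1)) (b ^ (β + 1)) b := by
  have hW := isLatticeWeight_of_parameters hb0 hb1 hα hβ
  have hp : monicLittleQJacobi α β b = littleJacobi (b ^ (α + 1)) (b ^ (β + 1)) b :=
    funext (monicLittleQJacobi_eq hb0 α β)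
  have hinner := skewInner_eq hb0 hb1 hα hβ
  set c := (1 - b ^ 2) ^ 2 * ((b ^ 2) ^ (-(α + 1) / 8)) ^ 2 with hcdef
  have hb2 : 0 < 1 - b ^ 2 := sub_pos.2 (pow_lt_one₀ hb0.le hb1 two_ne_zero)
  have hc : c ≠ 0 := by positivity
  rw [hp]
  constructor
  · rintro ⟨⟨hm, hd, hee, hoo, u, hu, heo⟩, hn⟩
    simp only [hinner, mul_eq_zero, hc, false_or] at hee hoo heo
    refine funext (hW.eq_skewJacobi hm hd hee hoo (fun i j hij => ?_) hn)
    have := heo i j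
    rw [if_neg hij] at this
    exact (mul_eq_zero.1 this).resolve_left hc
  · rintro rfl
    refine ⟨⟨hW.monic_skewJacobi, fun n => natDegree_eq_of_degree_eq_some (hW.degree_skewJacobi n),
      fun i j => ?_, fun i j => ?_, fun i => c * -((raiseCoeff (b ^ (α + 1)) (b ^ (β + 1)) b
        (2 * i))⁻¹ * hW.jacobiNorm (2 * i)), fun i => mul_ne_zero hc (hW.skewForm_norm_ne_zero i),
        fun i j => ?_⟩, IsLatticeWeight.skewJacobi_isNormalizedAgainst _ _ _⟩
    · rw [hinner, hW.skewForm_even_even, mul_zero]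
    · rw [hinner, hW.skewForm_odd_odd, mul_zero]
    · rw [hinner, hW.skewForm_even_odd, mul_ite, mul_zero]

theorem raiseRatio_eq_connCoeff (hb0 : 0 < b) (hb1 : b < 1) (hα : -1 < α) (hβ : -1 < β) (j : ℕ) :
    raiseRatio (b ^ (α + 1)) (b ^ (β + 1)) b (2 * j + 1) = connCoeff α β (b ^ 2) (j + 1) := by
  have hW := isLatticeWeight_of_parameters hb0 hb1 hα hβ
  -- The index `2 * j + 1` is at least one, so here the quotient of denominators can be reduced.
  have hδ : jacobiDenom (b ^ (α + 1)) (b ^ (β + 1)) b (2 * j + 1) /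
      jacobiDenom (b ^ (α + 1)) (b ^ (β + 1)) b (2 * j + 2) =
      (1 - b ^ (α + 1) * b ^ (β + 1) * b ^ (2 * j)) /
      ((1 - b ^ (α + 1) * b ^ (β + 1) * b ^ (2 * (2 * j) + 1)) *
        (1 - b ^ (α + 1) * b ^ (β + 1) * b ^ (2 * (2 * j) + 2))) := by
    rw [div_eq_div_iff (hW.jacobiDenom_pos _).ne'
      (mul_ne_zero (hW.one_sub_mul_ne_zero _) (hW.one_sub_mul_ne_zero _))]
    linear_combination
      -jacobiDenom_succ_succ (A := b ^ (α + 1)) (B := b ^ (β + 1)) hb0.ne' (2 * j)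
  rw [hW.raiseRatio_eq, hδ, connCoeff]
  simp only [sq_rpow hb0]
  push_cast
  rw [rpow_eq_mul_pow hb0 (y := α + 1) (4 * j + 3)
      (x := 2 * (2 * ((j : ℝ) + 1) + α / 2)) (by push_cast; ring),
    rpow_eq_mul_mul_pow hb0 (α := α) (β := β) (2 * j)
      (x := 2 * ((j : ℝ) + 1 + (α + β) / 2)) (by push_cast; ring),
    rpow_eq_mul_pow hb0 (y := α + 1) (2 * j + 1)
      (x := 2 * ((j : ℝ) + 1 + α / 2)) (by push_cast; ring),
    rpow_eq_mul_pow hb0 (y := β + 1) (2 * j + 1)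
      (x := 2 * ((j : ℝ) + 1 + β / 2)) (by push_cast; ring),
    rpow_eq_mul_mul_pow hb0 (α := α) (β := β) (4 * j + 4)
      (x := 2 * (2 * ((j : ℝ) + 1) + (α + β + 2) / 2)) (by push_cast; ring),
    rpow_eq_mul_mul_pow hb0 (α := α) (β := β) (4 * j + 3)
      (x := 2 * (2 * ((j : ℝ) + 1) + (α + β + 1) / 2)) (by push_cast; ring),
    rpow_eq_mul_mul_pow hb0 (α := α) (β := β) (4 * j + 2)
      (x := 2 * (2 * ((j : ℝ) + 1) + (α + β) / 2)) (by push_cast; ring),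
    rpow_eq_mul_mul_pow hb0 (α := α) (β := β) (4 * j + 1)
      (x := 2 * (2 * ((j : ℝ) + 1) + (α + β - 1) / 2)) (by push_cast; ring),
    div_mul_div_comm]
  congr 1 <;> ring_nf

theorem eq_skewJacobi_iff (hb0 : 0 < b) (hb1 : b < 1) (hα : -1 < α) (hβ : -1 < β)
    (Q : ℕ → ℝ[X]) : Q = skewJacobi (b ^ (α + 1)) (b ^ (β + 1)) b ↔
      (∀ j, Q (2 * j) = monicLittleQJacobi α β b (2 * j)) ∧ Q 1 = monicLittleQJacobi α β b 1 ∧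
        ∀ j, 1 ≤ j → Q (2 * j + 1) = monicLittleQJacobi α β b (2 * j + 1) -
          C (connCoeff α β (b ^ 2) j) * monicLittleQJacobi α β b (2 * j - 1) := by
  simp_rw [monicLittleQJacobi_eq hb0]
  have hodd : ∀ j, skewJacobi (b ^ (α + 1)) (b ^ (β + 1)) b (2 * (j + 1) + 1) =
      littleJacobi (b ^ (α + 1)) (b ^ (β + 1)) b (2 * (j + 1) + 1) -
        C (connCoeff α β (b ^ 2) (j + 1)) *
          littleJacobi (b ^ (α + 1)) (b ^ (β + 1)) b (2 * (j + 1) - 1) := fun j => by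
    rw [skewJacobi_odd_succ, raiseRatio_eq_connCoeff hb0 hb1 hα hβ]
    rfl
  constructor
  · rintro rfl
    refine ⟨skewJacobi_even _ _ _, rfl, fun j hj => ?_⟩
    obtain ⟨i, rfl⟩ := Nat.exists_eq_add_of_le' hj
    exact hodd i
  · rintro ⟨h0, h1, h⟩
    funext n
    rcases Nat.even_or_odd' n with ⟨j, rfl | rfl⟩
    · rw [h0, skewJacobi_even]
    · rcases j with _ | j
      · exact h1
      · rw [h _ (by omega), hodd]

theorem invConnCoeff_self (α β : ℝ) (q : ℝ) (j : ℕ) : invConnCoeff α β q j j = 1 := by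
  simp [invConnCoeff, qPoch]

/-- Iterating `p (2j+1) = Q (2j+1) + c_j p (2j-1)` makes the inverse coefficient the product of the
`c_k` with `i < k ≤ j`. Each new `c_k` adds four consecutive factors in base `b` to the denominator.
-/
theorem invConnCoeff_succ (hb0 : 0 < b) {i j : ℕ} (hij : i ≤ j) :
    invConnCoeff α β (b ^ 2) (j + 1) i =
      connCoeff α β (b ^ 2) (j + 1) * invConnCoeff α β (b ^ 2) j i := by
  obtain ⟨d, rfl⟩ := Nat.exists_eq_add_of_le hij
  have hb2 : 0 < b ^ 2 := by positivity
  have hpow : ∀ x y : ℝ, y = x + d → (b ^ 2) ^ x * (b ^ 2) ^ d = (b ^ 2) ^ y := fun x y h => by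
    rw [h, Real.rpow_add hb2, Real.rpow_natCast]
  have hpow' : ∀ (x y : ℝ) (k : ℕ), 2 * y = 2 * x + k →
      (b ^ 2) ^ x * b ^ k = (b ^ 2) ^ y := fun x y k h => by
    rw [sq_rpow hb0, sq_rpow hb0, h, Real.rpow_add hb0, Real.rpow_natCast]
  have hden : ∀ x : ℝ, qPoch x b (4 * (d + 1)) = qPoch x b (4 * d) * ((1 - x * b ^ (4 * d)) *
      (1 - x * b ^ (4 * d + 1)) * (1 - x * b ^ (4 * d + 2)) * (1 - x * b ^ (4 * d + 3))) :=
    fun x => by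
      rw [mul_add, mul_one, qPoch_succ, qPoch_succ, qPoch_succ, qPoch_succ]
      ring
  rw [invConnCoeff, invConnCoeff, connCoeff, div_mul_div_comm, sq_rpow_half hb0,
    show i + d + 1 - i = d + 1 by omega, show i + d - i = d by omega, qPoch_succ, qPoch_succ,
    qPoch_succ, qPoch_succ, hden]
  rw [hpow _ ((i + d + 1 : ℕ) + (α + β) / 2) (by push_cast; ring),
    hpow _ ((i + d + 1 : ℕ) + α / 2) (by push_cast; ring),
    hpow _ ((i + d + 1 : ℕ) + β / 2) (by push_cast; ring),
    show (b ^ 2) ^ (i + 1) * (b ^ 2) ^ d = (b ^ 2) ^ (i + d + 1) by ring,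
    hpow' _ (2 * (i + d + 1 : ℕ) + (α + β - 1) / 2) _ (by push_cast; ring),
    hpow' _ (2 * (i + d + 1 : ℕ) + (α + β) / 2) _ (by push_cast; ring),
    hpow' _ (2 * (i + d + 1 : ℕ) + (α + β + 1) / 2) _ (by push_cast; ring),
    hpow' _ (2 * (i + d + 1 : ℕ) + (α + β + 2) / 2) _ (by push_cast; ring)]
  have hexp : (b ^ 2) ^ ((((i + d + 1 : ℕ) : ℝ) - i) * (i + (i + d + 1 : ℕ) + 1 + α / 2)) =
      (b ^ 2) ^ (2 * ((i + d + 1 : ℕ) : ℝ) + α / 2) *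
        (b ^ 2) ^ ((((i + d : ℕ) : ℝ) - i) * (i + (i + d : ℕ) + 1 + α / 2)) := by
    rw [← Real.rpow_add hb2]
    congr 1
    push_cast
    ring
  rw [hexp]
  congr 1 <;> ring

theorem sum_invConnCoeff (hb0 : 0 < b) (Q : ℕ → ℝ[X]) (j : ℕ) :
    ∑ i ∈ Finset.range (j + 1 + 1), C (invConnCoeff α β (b ^ 2) (j + 1) i) * Q (2 * i + 1) =
      C (connCoeff α β (b ^ 2) (j + 1)) *
        ∑ i ∈ Finset.range (j + 1), C (invConnCoeff α β (b ^ 2) j i) * Q (2 * i + 1) +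
          Q (2 * (j + 1) + 1) := by
  rw [Finset.sum_range_succ, invConnCoeff_self, C_1, one_mul, Finset.mul_sum]
  congr 1
  refine Finset.sum_congr rfl fun i hi => ?_
  rw [invConnCoeff_succ hb0 (by simpa [Nat.lt_succ_iff] using hi), C_mul, mul_assoc]

theorem connection_iff_inverse (hb0 : 0 < b) (p Q : ℕ → ℝ[X]) :
    ((∀ j, Q (2 * j) = p (2 * j)) ∧ Q 1 = p 1 ∧ ∀ j, 1 ≤ j → Q (2 * j + 1) = p (2 * j + 1) -
        C (connCoeff α β (b ^ 2) j) * p (2 * j - 1)) ↔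
      (∀ j, p (2 * j) = Q (2 * j)) ∧ ∀ j, p (2 * j + 1) =
        ∑ i ∈ Finset.range (j + 1), C (invConnCoeff α β (b ^ 2) j i) * Q (2 * i + 1) := by
  refine and_congr (forall_congr' fun j => eq_comm) ⟨?_, fun h => ⟨?_, fun j hj => ?_⟩⟩
  · rintro ⟨h1, h⟩ j
    induction j with
    | zero => simp [invConnCoeff_self, h1]
    | succ j ih =>
      have := h (j + 1) (by omega)
      rw [show 2 * (j + 1) - 1 = 2 * j + 1 by omega] at this
      rw [sum_invConnCoeff hb0, ← ih, this, add_sub_cancel]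
  · simpa [invConnCoeff_self] using (h 0).symm
  · obtain ⟨i, rfl⟩ := Nat.exists_eq_add_of_le' hj
    rw [show 2 * (i + 1) - 1 = 2 * i + 1 by omega, h (i + 1), sum_invConnCoeff hb0, ← h i,
      add_sub_cancel_left]

end weight

/-! ### The multiple integral as a product of skew norms -/

theorem prod_neg_one_pow_range (n : ℕ) : ∏ i ∈ Finset.range (2 * n), (-1 : ℝ) ^ i = (-1) ^ n := by
  induction n with
  | zero => simp
  | succ n ih =>
    rw [mul_add, mul_one, Finset.prod_range_succ, Finset.prod_range_succ, ih, pow_succ (-1 : ℝ) (2 * n),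
      pow_mul]
    simp [pow_succ]

/-- The product of differences `z_j - z_k`, `j < k`, of an even number of variables as a determinant
of monic polynomials. -/
theorem prod_sub_eq_det {n : ℕ} (z : Fin (2 * n) → ℝ) (p : ℕ → ℝ[X]) (hm : ∀ k, (p k).Monic)
    (hd : ∀ k, (p k).natDegree = k) : ∏ j, ∏ k ∈ Finset.Ioi j, (z j - z k) =
      (-1) ^ n * (Matrix.of fun i j : Fin (2 * n) => (p j).eval (z i)).det := by
  have h1 : (Matrix.of fun i j : Fin (2 * n) => (p j).eval (z i)).det =
      (Matrix.vandermonde z).det := by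
    rw [Matrix.det_eval_matrixOfPolynomials_eq_det_vandermonde z (fun j => p j)
      (fun i => hd i) (fun i => hm i)]
  -- The differences have the order opposite to Vandermonde's. Negating the variables corrects this,
  -- and the column signs multiply to `(-1) ^ n`.
  have h2 : (Matrix.vandermonde fun i => -z i).det = ∏ j, ∏ k ∈ Finset.Ioi j, (z j - z k) := by
    rw [Matrix.det_vandermonde]
    refine Finset.prod_congr rfl fun j _ => Finset.prod_congr rfl fun k _ => ?_
    ring
  have h3 : (Matrix.vandermonde fun i => -z i) =
      Matrix.of fun i j : Fin (2 * n) => (-1) ^ (j : ℕ) * Matrix.vandermonde z i j := by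
    ext i j
    rw [Matrix.vandermonde_apply, Matrix.of_apply, Matrix.vandermonde_apply, neg_pow]
  rw [← h2, h3, Matrix.det_mul_row, h1, Fin.prod_univ_eq_prod_range (fun i => (-1 : ℝ) ^ i),
    prod_neg_one_pow_range]

section

variable {b α β : ℝ}

theorem aomotoPoint_eq (hb0 : 0 < b) {N : ℕ} (μ : Fin N → ℕ) (i : Fin N) :
    aomotoPoint (b ^ 2) μ i = b ^ chainIndex μ i := by
  rw [aomotoPoint, sq_rpow hb0, ← Real.rpow_natCast b (chainIndex μ i), chainIndex]
  congr 1
  push_cast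
  ring

theorem aomotoTerm_eq (hb0 : 0 < b) {n : ℕ} (p : ℕ → ℝ[X]) (hm : ∀ k, (p k).Monic)
    (hd : ∀ k, (p k).natDegree = k) (μ : Fin (2 * n) → ℕ) :
    aomotoTerm (b ^ 2) (aomotoIntegrand α β (b ^ 2)) μ = (1 - b ^ 2) ^ (2 * n) * (-1) ^ n *
      (Matrix.of fun i j : Fin (2 * n) => (fun k m => (p k).eval (b ^ m) *
        qBetaWeight (b ^ ((α + 1) / 2)) (b ^ (β + 1)) b m) j (chainIndex μ i)).det := by
  have h1 : (Matrix.of fun i j : Fin (2 * n) => (fun k m => (p k).eval (b ^ m) *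
        qBetaWeight (b ^ ((α + 1) / 2)) (b ^ (β + 1)) b m) j (chainIndex μ i)) =
      Matrix.of fun i j : Fin (2 * n) =>
        qBetaWeight (b ^ ((α + 1) / 2)) (b ^ (β + 1)) b (chainIndex μ i) *
          (Matrix.of fun i j : Fin (2 * n) => (p j).eval (b ^ chainIndex μ i)) i j := by
    ext i j
    simp [mul_comm]
  rw [h1, Matrix.det_mul_column, aomotoTerm, aomotoIntegrand, prod_sub_eq_det _ p hm hd]
  simp_rw [aomotoPoint_eq hb0, ← mul_weight_eq_qBetaWeight hb0, Finset.prod_mul_distrib]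
  ring

theorem aomotoTerm_summable (hb0 : 0 < b) (hb1 : b < 1) (hα : -1 < α) (hβ : -1 < β) (n : ℕ) :
    Summable fun μ : Fin (2 * n) → ℕ => aomotoTerm (b ^ 2) (aomotoIntegrand α β (b ^ 2)) μ := by
  have hW := isLatticeWeight_of_parameters hb0 hb1 hα hβ
  simp_rw [aomotoTerm_eq hb0 (skewJacobi (b ^ (α + 1)) (b ^ (β + 1)) b) hW.monic_skewJacobi
    fun n => natDegree_eq_of_degree_eq_some (hW.degree_skewJacobi n)]
  exact (summable_det_chain _ fun i => hW.summable_lattice _).mul_left _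

theorem aomotoIntegral_eq (hb0 : 0 < b) (hb1 : b < 1) (hα : -1 < α) (hβ : -1 < β) (n : ℕ) :
    aomotoIntegral (b ^ 2) (N := 2 * n) (aomotoIntegrand α β (b ^ 2)) =
      (1 - b ^ 2) ^ (2 * n) * ∏ m ∈ Finset.range n,
        (-((raiseCoeff (b ^ (α + 1)) (b ^ (β + 1)) b (2 * m))⁻¹ *
          (isLatticeWeight_of_parameters hb0 hb1 hα hβ).jacobiNorm (2 * m))) := by
  have hW := isLatticeWeight_of_parameters hb0 hb1 hα hβ
  rw [aomotoIntegral]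
  simp_rw [aomotoTerm_eq hb0 (skewJacobi (b ^ (α + 1)) (b ^ (β + 1)) b) hW.monic_skewJacobi
    fun n => natDegree_eq_of_degree_eq_some (hW.degree_skewJacobi n)]
  -- The antisymmetrized half-pairing is the skew form with its arguments exchanged, so its values
  -- are minus the skew norms; the sign `(-1) ^ n` of the difference product compensates.
  rw [tsum_mul_left, tsum_det_chain n _ (fun i => hW.summable_lattice _)
    (fun m => (raiseCoeff (b ^ (α + 1)) (b ^ (β + 1)) b (2 * m))⁻¹ * hW.jacobiNorm (2 * m)),
    Finset.prod_neg, Finset.card_range, mul_assoc]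
  · intro m k
    exact hW.skewForm_even_even k m
  · intro m k
    exact hW.skewForm_odd_odd k m
  · intro m k
    refine (hW.skewForm_swap _ _).trans ?_
    rw [hW.skewForm_even_odd]
    split_ifs <;> simp

/-! ### Evaluation of the product formula -/

theorem qPochReal_eq (hb0 : 0 < b) (hb1 : b < 1) {ν x : ℝ} (hx : x < 1) (k : ℕ)
    (h : b * b ^ ν = x * b ^ k) :
    qPochReal b b ν = qPochInf b b * qPoch x b k / qPochInf x b := by
  have h1 := (qPochInf_pos (mul_pow_lt_one hx hb0.le hb1 k) hb0.le hb1).ne'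
  have h2 := (qPoch_pos hx hb0.le hb1 k).ne'
  rw [qPochReal, h, qPochInf_eq_qPoch_mul x hb0.le hb1 k]
  field_simp

/-- The factor of the product formula for the multiple integral. -/
theorem skewNorm_eq (hb0 : 0 < b) (hb1 : b < 1) (hα : -1 < α) (hβ : -1 < β) (i : ℕ) :
    -((raiseCoeff (b ^ (α + 1)) (b ^ (β + 1)) b (2 * i))⁻¹ *
      (isLatticeWeight_of_parameters hb0 hb1 hα hβ).jacobiNorm (2 * i)) =
    (b ^ 2) ^ (2 * (i : ℝ) ^ 2 + i * α + i + (α + 1) / 4) *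
      ((qPochReal b b (2 * i + α) * qPochReal b b (2 * i + β) * qPoch b b (2 * i)) /
        (qPochReal b b (4 * i + α + β + 2) *
          qPoch ((b ^ 2) ^ ((2 * i + α + β + 1) / 2)) b (2 * i))) := by
  have hW := isLatticeWeight_of_parameters hb0 hb1 hα hβ
  have hAB : b ^ (α + 1) * b ^ (β + 1) < 1 := by simpa using hW.mul_mul_pow_lt_one 0
  have hr : (b ^ ((α + 1) / 2)) ^ 2 = b ^ (α + 1) := by
    rw [← Real.rpow_two, ← Real.rpow_mul hb0.le, div_mul_cancel₀ _ two_ne_zero]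
  have h0 : hW.jacobiNorm 0 = b ^ ((α + 1) / 2) * (qPochInf b b *
      qPochInf (b ^ (α + 1) * b ^ (β + 1)) b /
        (qPochInf (b ^ (β + 1)) b * qPochInf (b ^ (α + 1)) b)) := by
    have h := jacobiNorm_zero_qBetaWeight (r := b ^ ((α + 1) / 2)) hb0 hb1 hW.B_pos hW.B_lt_one
      (by rw [hr]; exact hW)
    simp only [hr] at h
    exact h
  have hbb : ∀ x : ℝ, b * b ^ x = b ^ (x + 1) := fun x => by
    rw [Real.rpow_add_one hb0.ne', mul_comm]
  -- The real-index factorials are moved back to the base points `A`, `B` and `A * B`, whose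
  -- infinite products occur in the zeroth norm.
  rw [qPochReal_eq hb0 hb1 hW.A_lt_one (2 * i)
      ((hbb _).trans (rpow_eq_mul_pow hb0 _ (by push_cast; ring))),
    qPochReal_eq hb0 hb1 hW.B_lt_one (2 * i)
      ((hbb _).trans (rpow_eq_mul_pow hb0 _ (by push_cast; ring))),
    qPochReal_eq hb0 hb1 hAB (4 * i + 1)
      ((hbb _).trans (rpow_eq_mul_mul_pow hb0 _ (by push_cast; ring))),
    sq_rpow hb0, sq_rpow hb0, show 2 * ((2 * (i : ℝ) + α + β + 1) / 2) = α + β + (2 * i : ℕ) + 1 by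
      push_cast; ring, rpow_eq_mul_mul_pow_div hb0, ← jacobiDenom, hW.jacobiNorm_eq, h0, raiseCoeff,
    qPoch_succ]
  have hexp : b ^ (2 * (2 * (i : ℝ) ^ 2 + i * α + i + (α + 1) / 4)) =
      b ^ ((α + 1) / 2) * (b ^ (α + 1)) ^ (2 * i) * b ^ (2 * i * (2 * i - 1)) * b ^ (2 * i) := by
    have h1 : b ^ (2 * i * (2 * i - 1)) * b ^ (2 * i) = b ^ (4 * i ^ 2) := by
      rw [← pow_add]
      congr 1
      rcases i with _ | i
      · simp
      · rw [show 2 * (i + 1) - 1 = 2 * i + 1 by omega]; ring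
    rw [mul_assoc, h1, ← Real.rpow_natCast (b ^ (α + 1)), ← Real.rpow_natCast b (4 * i ^ 2), ← Real.rpow_mul hb0.le,
      ← Real.rpow_add hb0, ← Real.rpow_add hb0]
    congr 1
    push_cast
    ring
  rw [hexp, show 2 * (2 * i) = 4 * i by ring]
  have h1 := (qPochInf_pos hb1 hb0.le hb1).ne'
  have h2 := (qPochInf_pos hAB hb0.le hb1).ne'
  have h3 := (qPochInf_pos hW.A_lt_one hb0.le hb1).ne'
  have h4 := (qPochInf_pos hW.B_lt_one hb0.le hb1).ne'
  have h5 := (hW.jacobiDenom_pos (2 * i)).ne'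
  have h6 := (qPoch_pos hAB hb0.le hb1 (4 * i)).ne'
  have h7 := hW.one_sub_mul_ne_zero (4 * i)
  have h8 : b ^ (2 * i) ≠ 0 := pow_ne_zero _ hb0.ne'
  generalize qPochInf b b = x1 at *
  generalize qPochInf (b ^ (α + 1) * b ^ (β + 1)) b = x2 at *
  generalize qPochInf (b ^ (α + 1)) b = x3 at *
  generalize qPochInf (b ^ (β + 1)) b = x4 at *
  generalize jacobiDenom (b ^ (α + 1)) (b ^ (β + 1)) b (2 * i) = x5 at *
  generalize qPoch (b ^ (α + 1) * b ^ (β + 1)) b (4 * i) = x6 at *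
  generalize 1 - b ^ (α + 1) * b ^ (β + 1) * b ^ (4 * i) = x7 at *
  generalize b ^ (2 * i) = x8 at *
  generalize qPoch (b ^ (α + 1)) b (2 * i) = y1
  generalize qPoch (b ^ (β + 1)) b (2 * i) = y2
  generalize qPoch b b (2 * i) = y3
  generalize b ^ ((α + 1) / 2) = y4
  generalize (b ^ (α + 1)) ^ (2 * i) = y5
  generalize b ^ (2 * i * (2 * i - 1)) = y6
  clear hexp h0 hbb hr hAB
  field_simp

theorem rpow_mul_prod_eq_prod {q : ℝ} (hq : 0 < q) (α : ℝ) (R : ℕ → ℝ) (n : ℕ) :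
    q ^ ((n : ℝ) * (n - 1) * (4 * n + 3 * α + 1) / 6 + n * (α + 1) / 4) *
        ∏ i ∈ Finset.range n, R i =
      ∏ i ∈ Finset.range n, q ^ (2 * (i : ℝ) ^ 2 + i * α + i + (α + 1) / 4) * R i := by
  rw [Finset.prod_mul_distrib]
  congr 1
  induction n with
  | zero => simp
  | succ n ih =>
    rw [Finset.prod_range_succ, ← ih, ← Real.rpow_add hq]
    congr 1
    push_cast
    ring

theorem aomotoIntegral_formula (hb0 : 0 < b) (hb1 : b < 1) (hα : -1 < α) (hβ : -1 < β) (n : ℕ) :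
    aomotoIntegral (b ^ 2) (N := 2 * n) (aomotoIntegrand α β (b ^ 2)) =
      (b ^ 2) ^ ((n : ℝ) * (n - 1) * (4 * n + 3 * α + 1) / 6 + n * (α + 1) / 4) *
        (1 - b ^ 2) ^ (2 * n) *
        ∏ i ∈ Finset.range n,
          (qPochReal b b (2 * i + α) * qPochReal b b (2 * i + β) * qPoch b b (2 * i)) /
            (qPochReal b b (4 * i + α + β + 2) *
              qPoch ((b ^ 2) ^ ((2 * i + α + β + 1) / 2)) b (2 * i)) := by
  rw [aomotoIntegral_eq hb0 hb1 hα hβ, mul_right_comm, rpow_mul_prod_eq_prod (by positivity),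
    mul_comm]
  congr 1
  exact Finset.prod_congr rfl fun i _ => skewNorm_eq hb0 hb1 hα hβ i

theorem qPochReal_div_qPochReal (hb0 : 0 < b) (hb1 : b < 1) {s : ℝ} (hs : -2 < s) (hs' : s ≠ -1)
    (i : ℕ) : qPochReal b b (2 * i + s) / qPochReal b b (4 * i + s) =
      1 / qPoch ((b ^ 2) ^ ((2 * i + s + 1) / 2)) b (2 * i) := by
  have hx : (b ^ 2) ^ ((2 * i + s + 1) / 2) = b ^ (2 * i + s + 1) := by
    rw [sq_rpow hb0]
    congr 1
    ring
  have hbb : ∀ x : ℝ, b * b ^ x = b ^ (x + 1) := fun x => by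
    rw [Real.rpow_add_one hb0.ne', mul_comm]
  have hy : b ^ (4 * i + s + 1) = b ^ (2 * i + s + 1) * b ^ (2 * i) :=
    rpow_eq_mul_pow hb0 _ (by push_cast; ring)
  have h1 := (qPochInf_pos hb1 hb0.le hb1).ne'
  -- A vanishing factor would require `4i + s + 1 + k = 0`. With `s > -2` this forces `i = k = 0`
  -- and `s = -1`, the excluded case.
  have h2 : qPochInf (b ^ (4 * i + s + 1)) b ≠ 0 := by
    refine qPochInf_ne_zero hb0.le hb1 fun k h => ?_
    rw [← Real.rpow_natCast, ← Real.rpow_add hb0] at h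
    have h0 : 4 * (i : ℝ) + s + 1 + k = 0 := by
      by_contra hne
      exact hne (((Real.rpow_right_inj hb0 hb1.ne).1 (h.trans (Real.rpow_zero b).symm)))
    have hik : i = 0 ∧ k = 0 := by
      have : ((4 * i + k : ℕ) : ℝ) < 1 := by push_cast; linarith
      have : 4 * i + k < 1 := by exact_mod_cast this
      omega
    rw [hik.1, hik.2] at h0
    exact hs' (by push_cast at h0; linarith)
  rw [hx, qPochReal, qPochReal, hbb, hbb, qPochInf_eq_qPoch_mul (b ^ (2 * i + s + 1)) hb0.le hb1
    (2 * i), ← hy]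
  generalize qPochInf (b ^ (4 * i + s + 1)) b = y at *
  field_simp

theorem aomotoIntegral_formula' (hb0 : 0 < b) (hb1 : b < 1) (hα : -1 < α) (hβ : -1 < β)
    (hαβ : α + β ≠ -1) (n : ℕ) :
    aomotoIntegral (b ^ 2) (N := 2 * n) (aomotoIntegrand α β (b ^ 2)) =
      (b ^ 2) ^ ((n : ℝ) * (n - 1) * (4 * n + 3 * α + 1) / 6 + n * (α + 1) / 4) *
        (1 - b ^ 2) ^ (2 * n) *
        ∏ i ∈ Finset.range n,
          (qPochReal b b (2 * i + α + β) * qPochReal b b (2 * i + α) * qPochReal b b (2 * i + β) *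
            qPoch b b (2 * i)) /
            (qPochReal b b (4 * i + α + β + 2) * qPochReal b b (4 * i + α + β)) := by
  rw [aomotoIntegral_formula hb0 hb1 hα hβ]
  congr 1
  refine Finset.prod_congr rfl fun i _ => ?_
  have h := qPochReal_div_qPochReal hb0 hb1 (s := α + β) (by linarith) hαβ i
  simp only [← add_assoc] at h
  rw [div_mul_eq_div_div, div_eq_mul_one_div _ (qPoch _ _ _), ← h, mul_comm (qPochReal _ _ _ *
    qPochReal _ _ _), mul_assoc, mul_assoc, mul_comm (qPochReal b b (2 * i + α + β))]
  ring

end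

end

theorem proposition4p1 (α β q : ℝ) (hα : -1 < α) (hβ : -1 < β) (hq0 : 0 < q) (hq1 : q < 1) :
    -- the double series defining the skew inner product converges on polynomials
    (∀ φ ψ : ℝ[X], Summable fun kl : ℕ × ℕ =>
      skewInnerTerm q (skewWeight α β q) (fun x => φ.eval x) (fun x => ψ.eval x) kl.1 kl.2) ∧
    -- the (normalized) skew orthogonal polynomials in terms of the little q-Jacobi polynomials
    (∀ Q : ℕ → ℝ[X],
      (IsSkewOrthogonal q (skewWeight α β q) Q ∧
        IsNormalizedAgainst (monicLittleQJacobi α β (q ^ (1 / 2 : ℝ))) Q) ↔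
      ((∀ j, Q (2 * j) = monicLittleQJacobi α β (q ^ (1 / 2 : ℝ)) (2 * j)) ∧
        Q 1 = monicLittleQJacobi α β (q ^ (1 / 2 : ℝ)) 1 ∧
        ∀ j, 1 ≤ j → Q (2 * j + 1) =
          monicLittleQJacobi α β (q ^ (1 / 2 : ℝ)) (2 * j + 1) -
            C (connCoeff α β q j) * monicLittleQJacobi α β (q ^ (1 / 2 : ℝ)) (2 * j - 1))) ∧
    -- the equivalent inverse relation
    (∀ Q : ℕ → ℝ[X],
      (IsSkewOrthogonal q (skewWeight α β q) Q ∧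
        IsNormalizedAgainst (monicLittleQJacobi α β (q ^ (1 / 2 : ℝ))) Q) ↔
      ((∀ j, monicLittleQJacobi α β (q ^ (1 / 2 : ℝ)) (2 * j) = Q (2 * j)) ∧
        ∀ j, monicLittleQJacobi α β (q ^ (1 / 2 : ℝ)) (2 * j + 1) =
          ∑ i ∈ Finset.range (j + 1), C (invConnCoeff α β q j i) * Q (2 * i + 1))) ∧
    -- the q-integral over 2n particles; the quotient of `(q^{1/2};q^{1/2})_{2i+α+β}` by
    -- `(q^{1/2};q^{1/2})_{4i+α+β}` is first written as `1 / (q^{(2i+α+β+1)/2};q^{1/2})_{2i}`,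
    -- which makes sense for all parameters
    (∀ n : ℕ,
      (Summable fun μ : Fin (2 * n) → ℕ => aomotoTerm q (aomotoIntegrand α β q) μ) ∧
      (aomotoIntegral q (N := 2 * n) (aomotoIntegrand α β q) =
        q ^ ((n : ℝ) * (n - 1) * (4 * n + 3 * α + 1) / 6 + n * (α + 1) / 4) *
          (1 - q) ^ (2 * n) *
          ∏ i ∈ Finset.range n,
            (qPochReal (q ^ (1 / 2 : ℝ)) (q ^ (1 / 2 : ℝ)) (2 * i + α) *
              qPochReal (q ^ (1 / 2 : ℝ)) (q ^ (1 / 2 : ℝ)) (2 * i + β) *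
              qPoch (q ^ (1 / 2 : ℝ)) (q ^ (1 / 2 : ℝ)) (2 * i)) /
            (qPochReal (q ^ (1 / 2 : ℝ)) (q ^ (1 / 2 : ℝ)) (4 * i + α + β + 2) *
              qPoch (q ^ ((2 * i + α + β + 1) / 2)) (q ^ (1 / 2 : ℝ)) (2 * i))) ∧
      (α + β ≠ -1 →
        aomotoIntegral q (N := 2 * n) (aomotoIntegrand α β q) =
        q ^ ((n : ℝ) * (n - 1) * (4 * n + 3 * α + 1) / 6 + n * (α + 1) / 4) *
          (1 - q) ^ (2 * n) *
          ∏ i ∈ Finset.range n,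
            (qPochReal (q ^ (1 / 2 : ℝ)) (q ^ (1 / 2 : ℝ)) (2 * i + α + β) *
              qPochReal (q ^ (1 / 2 : ℝ)) (q ^ (1 / 2 : ℝ)) (2 * i + α) *
              qPochReal (q ^ (1 / 2 : ℝ)) (q ^ (1 / 2 : ℝ)) (2 * i + β) *
              qPoch (q ^ (1 / 2 : ℝ)) (q ^ (1 / 2 : ℝ)) (2 * i)) /
            (qPochReal (q ^ (1 / 2 : ℝ)) (q ^ (1 / 2 : ℝ)) (4 * i + α + β + 2) *
              qPochReal (q ^ (1 / 2 : ℝ)) (q ^ (1 / 2 : ℝ)) (4 * i + α + β)))) := by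
  obtain ⟨b, hb0, hb1, rfl⟩ : ∃ b : ℝ, 0 < b ∧ b < 1 ∧ q = b ^ 2 :=
    ⟨√q, Real.sqrt_pos.2 hq0, (Real.sqrt_lt' one_pos).2 (by rwa [one_pow]), (Real.sq_sqrt hq0.le).symm⟩
  simp only [sq_rpow_half hb0]
  have hiff := fun Q => (isSkewOrthogonal_and_normalized_iff hb0 hb1 hα hβ Q).trans
    (eq_skewJacobi_iff hb0 hb1 hα hβ Q)
  exact ⟨summable_skewInnerTerm hb0 hb1 hα hβ, hiff,
    fun Q => (hiff Q).trans (connection_iff_inverse hb0 _ Q),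
    fun n => ⟨aomotoTerm_summable hb0 hb1 hα hβ n, aomotoIntegral_formula hb0 hb1 hα hβ n,
      fun h => aomotoIntegral_formula' hb0 hb1 hα hβ h n⟩⟩
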